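/- Let $p$ be a prime and let $K$ be a complete discretely valued field of mixed characteristic $(0,p)$ whose residue field $k_K$ satisfies $[k_K:k_K^p]=p^d<\infty$. Let $t_1,\dots,t_d\in\mathcal{O}_K$ be a lift of a $p$-basis of $k_K$, fix an algebraic closure $\overline{K}$ of $K$, put $K_\infty=K(\mu_{p^\infty},t_1^{p^{-\infty}},\dots,t_d^{p^{-\infty}})\subset\overline{K}$ and $\Gamma=\mathrm{Gal}(K_\infty/K)$ (with its Krull topology), and let $\chi:\Gamma\to\mathbb{Z}_p^\times$ be the cyclotomic character. Let $\log:\mathbb{Z}_p^\times\to\mathbb{Q}_p\subset K$ be the $p$-adic logarithm (the homomorphism given by the usual series on $1+p\mathbb{Z}_p$ and vanishing on the roots of unity). For $r\ge 1$ let $K[\log t]^{<r}$ be the $K$-vector space of polynomials of degree $<r$ in a variable $\log t$, on which $\Gamma$ acts $K$-linearly by $\gamma(f(\log t))=f(\log t+\log\chi(\gamma))$. Let $V$ be a finite-dimensional $K$-vector space with a continuous $K$-linear action of $\Gamma$, all of whose Jordan--H\"older factors are isomorphic to the one-dimensional trivial representation $K$. Then there are an integer $k\ge 0$ and integers $r_1,\dots,r_k\ge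 1$ such that $$V\cong K[\log t]^{<r_1}\oplus\dots\oplus K[\log t]^{<r_k}$$ as $K$-linear representations of $\Gamma$. -/

import Mathlib

open Filter Topology
open scoped NormedField Valued DirectSum Polynomial MonoidAlgebra

/-! ### The `p`-adic logarithm on `ℤ_pˣ` -/

/-- The series `log (1 + x) = ∑_{n ≥ 1} (-1)^(n-1) x^n / n` in `ℚ_p` (it converges for `‖x‖ < 1`). -/
noncomputable def padicLogOneAdd (p : ℕ) [Fact p.Prime] (x : ℚ_[p]) : ℚ_[p] :=
  ∑' n : ℕ, (-1) ^ n / ((n : ℚ_[p]) + 1) * x ^ (n + 1)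

/-- The `p`-adic logarithm `log : ℤ_pˣ → ℚ_p`, the homomorphism that is given by the usual series on
`1 + p ℤ_p` and kills the roots of unity of order prime to `p`:
`log u = (p - 1)⁻¹ log (u ^ (p - 1))`, where `u ^ (p - 1)` lies in `1 + p ℤ_p`. -/
noncomputable def padicUnitLog (p : ℕ) [Fact p.Prime] (u : ℤ_[p]ˣ) : ℚ_[p] :=
  ((p : ℚ_[p]) - 1)⁻¹ * padicLogOneAdd p (((u : ℤ_[p]) : ℚ_[p]) ^ (p - 1) - 1)

section PadicLog

variable {p : ℕ} [Fact p.Prime]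

theorem padic_norm_natCast_inv_le (n : ℕ) : ‖((n : ℚ_[p]) + 1)‖⁻¹ ≤ (n : ℝ) + 1 := by
  have h : ((n : ℚ_[p]) + 1) = ((n + 1 : ℕ) : ℚ_[p]) := by push_cast; rfl
  have hp : (0 : ℝ) < p := by exact_mod_cast (Fact.out : p.Prime).pos
  rw [h, Padic.norm_eq_zpow_neg_valuation (by exact_mod_cast n.succ_ne_zero),
    Padic.valuation_natCast, zpow_neg, inv_inv, zpow_natCast]
  have := Nat.le_of_dvd n.succ_pos (pow_padicValNat_dvd (p := p) (n := n + 1))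
  exact_mod_cast this

theorem padic_log_term_bound (a : ℚ_[p]) (ha : ‖a‖ ≤ 1) (x : ℚ_[p]) (n : ℕ) :
    ‖a / ((n : ℚ_[p]) + 1) * x ^ (n + 1)‖ ≤ ((n : ℝ) + 1) * ‖x‖ ^ (n + 1) := by
  rw [norm_mul, norm_div, norm_pow, div_eq_mul_inv]
  have := padic_norm_natCast_inv_le (p := p) n
  gcongr
  calc ‖a‖ * ‖((n : ℚ_[p]) + 1)‖⁻¹ ≤ 1 * ((n : ℝ) + 1) := by gcongr
    _ = _ := one_mul _

theorem padic_log_bound_summable (x : ℚ_[p]) (hx : ‖x‖ < 1) :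
    Summable fun n : ℕ ↦ ((n : ℝ) + 1) * ‖x‖ ^ (n + 1) := by
  have h := (summable_nat_add_iff 1).2
    (summable_pow_mul_geometric_of_norm_lt_one 1 (r := ‖x‖) (by simpa using hx))
  simpa using h

theorem padicLogOneAdd_summable (x : ℚ_[p]) (hx : ‖x‖ < 1) :
    Summable fun n : ℕ ↦ (-1) ^ n / ((n : ℚ_[p]) + 1) * x ^ (n + 1) :=
  Summable.of_norm_bounded (padic_log_bound_summable x hx)
    fun n ↦ padic_log_term_bound _ (by simp) x n

theorem padic_tendsto_choose (n : ℕ) :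
    Tendsto (fun N : ℕ ↦ (((p ^ N - 1).choose n : ℕ) : ℚ_[p])) atTop (𝓝 ((-1) ^ n)) := by
  induction n with
  | zero => simp
  | succ n ih =>
    have h0 : Tendsto (fun N : ℕ ↦ (((p ^ N).choose (n + 1) : ℕ) : ℚ_[p])) atTop (𝓝 0) := by
      have hp : Tendsto (fun N : ℕ ↦ (p : ℚ_[p]) ^ N) atTop (𝓝 0) :=
        tendsto_pow_atTop_nhds_zero_of_norm_lt_one (Padic.norm_p_lt_one)
      have := (hp.mul ih).div_const ((n : ℚ_[p]) + 1)
      rw [zero_mul, zero_div] at this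
      refine this.congr fun N ↦ ?_
      have hpos : 0 < p ^ N := pow_pos (Fact.out : p.Prime).pos N
      have hne : ((n : ℚ_[p]) + 1) ≠ 0 := by exact_mod_cast n.succ_ne_zero
      have key := Nat.add_one_mul_choose_eq (p ^ N - 1) n
      rw [Nat.sub_add_cancel hpos] at key
      rw [div_eq_iff hne]
      exact_mod_cast key
    have := h0.sub ih
    rw [zero_sub] at this
    rw [pow_succ, mul_neg_one]
    refine this.congr fun N ↦ ?_
    have hpos : 0 < p ^ N := pow_pos (Fact.out : p.Prime).pos N
    have key := Nat.choose_succ_succ' (p ^ N - 1) n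
    rw [Nat.sub_add_cancel hpos] at key
    rw [key]
    push_cast
    ring

/-- `log (1 + x) = lim_N ((1 + x) ^ (p ^ N) - 1) / p ^ N`. -/
theorem padicLogOneAdd_tendsto (x : ℚ_[p]) (hx : ‖x‖ < 1) :
    Tendsto (fun N : ℕ ↦ ((1 + x) ^ (p ^ N) - 1) / (p : ℚ_[p]) ^ N) atTop
      (𝓝 (padicLogOneAdd p x)) := by
  have main : Tendsto (fun N : ℕ ↦ ∑' n : ℕ,
      (((p ^ N - 1).choose n : ℕ) : ℚ_[p]) / ((n : ℚ_[p]) + 1) * x ^ (n + 1)) atTop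
      (𝓝 (padicLogOneAdd p x)) := by
    refine tendsto_tsum_of_dominated_convergence (padic_log_bound_summable x hx) ?_ ?_
    · intro n
      exact ((padic_tendsto_choose n).div_const _).mul_const _
    · refine Eventually.of_forall fun N n ↦ padic_log_term_bound _ ?_ x n
      simpa using Padic.norm_int_le_one (p := p) (((p ^ N - 1).choose n : ℕ) : ℤ)
  refine main.congr fun N ↦ ?_
  have hpos : 0 < p ^ N := pow_pos (Fact.out : p.Prime).pos N
  have hp0 : (p : ℚ_[p]) ^ N ≠ 0 :=
    pow_ne_zero _ (by exact_mod_cast (Fact.out : p.Prime).ne_zero)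
  rw [tsum_eq_sum (s := Finset.range (p ^ N)), eq_div_iff hp0, add_comm 1 x, add_pow,
    Finset.sum_range_succ', Finset.sum_mul]
  · simp only [one_pow, mul_one, pow_zero, Nat.choose_zero_right, Nat.cast_one, add_sub_cancel_right]
    refine Finset.sum_congr rfl fun n _ ↦ ?_
    have hne : ((n : ℚ_[p]) + 1) ≠ 0 := by exact_mod_cast n.succ_ne_zero
    have key := Nat.add_one_mul_choose_eq (p ^ N - 1) n
    rw [Nat.sub_add_cancel hpos] at key
    have key' : (p : ℚ_[p]) ^ N * ((p ^ N - 1).choose n : ℕ)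
        = ((p ^ N).choose (n + 1) : ℕ) * ((n : ℚ_[p]) + 1) := by exact_mod_cast key
    rw [div_mul_eq_mul_div, div_mul_eq_mul_div, div_eq_iff hne]
    linear_combination x ^ (n + 1) * key'
  · intro n hn
    rw [Finset.mem_range, not_lt] at hn
    rw [Nat.choose_eq_zero_of_lt (by omega)]
    simp

theorem padicLogOneAdd_mul (x y : ℚ_[p]) (hx : ‖x‖ < 1) (hy : ‖y‖ < 1) :
    padicLogOneAdd p ((1 + x) * (1 + y) - 1) = padicLogOneAdd p x + padicLogOneAdd p y := by
  have hxy : ‖(1 + x) * (1 + y) - 1‖ < 1 := by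
    have e : (1 + x) * (1 + y) - 1 = x * y + (x + y) := by ring
    rw [e]
    refine (Padic.nonarchimedean _ _).trans_lt (max_lt ?_ ?_)
    · rw [norm_mul]
      exact mul_lt_one_of_nonneg_of_lt_one_left (norm_nonneg _) hx hy.le
    · exact (Padic.nonarchimedean _ _).trans_lt (max_lt hx hy)
  have hp : Tendsto (fun N : ℕ ↦ (p : ℚ_[p]) ^ N) atTop (𝓝 0) :=
    tendsto_pow_atTop_nhds_zero_of_norm_lt_one (Padic.norm_p_lt_one)
  have hX := padicLogOneAdd_tendsto x hx
  have hY := padicLogOneAdd_tendsto y hy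
  refine tendsto_nhds_unique (padicLogOneAdd_tendsto _ hxy) ?_
  have h := ((hX.mul (hp.mul hY)).add hX).add hY
  rw [zero_mul, mul_zero, zero_add] at h
  refine h.congr fun N ↦ ?_
  have hp0 : (p : ℚ_[p]) ^ N ≠ 0 :=
    pow_ne_zero _ (by exact_mod_cast (Fact.out : p.Prime).ne_zero)
  rw [add_sub_cancel, mul_pow]
  field_simp
  ring

theorem padicInt_unit_pow_sub_one_norm_lt (u : ℤ_[p]ˣ) :
    ‖((u : ℤ_[p]) : ℚ_[p]) ^ (p - 1) - 1‖ < 1 := by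
  have h : ((u : ℤ_[p]) ^ (p - 1) - 1) ∈ IsLocalRing.maximalIdeal ℤ_[p] := by
    rw [← PadicInt.ker_toZMod, RingHom.mem_ker, map_sub, map_pow, map_one, sub_eq_zero]
    exact ZMod.pow_card_sub_one_eq_one (u.isUnit.map PadicInt.toZMod).ne_zero
  have := PadicInt.mem_nonunits.1 ((IsLocalRing.mem_maximalIdeal _).1 h)
  rw [PadicInt.norm_def] at this
  push_cast at this
  exact this

theorem padicUnitLog_mul (u v : ℤ_[p]ˣ) :
    padicUnitLog p (u * v) = padicUnitLog p u + padicUnitLog p v := by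
  have h := padicLogOneAdd_mul _ _ (padicInt_unit_pow_sub_one_norm_lt u)
    (padicInt_unit_pow_sub_one_norm_lt v)
  rw [add_sub_cancel, add_sub_cancel, ← mul_pow] at h
  unfold padicUnitLog
  rw [← mul_add, ← h]
  push_cast
  rfl

theorem padicUnitLog_one : padicUnitLog p 1 = 0 := by
  have := padicUnitLog_mul (p := p) 1 1
  rw [mul_one] at this
  exact left_eq_add.1 this

end PadicLog

/-! ### The field `K_∞` and its Galois group -/

/-- A family `t₁, …, t_d` in a field `k` of characteristic `p` is a `p`-basis if the monomials
`∏ t_j ^ (e_j)`, `0 ≤ e_j < p`, form a basis of `k` over its subfield `k ^ p`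
(so that `[k : k ^ p] = p ^ d`). -/
def IsPBasis (p : ℕ) [Fact p.Prime] {k : Type*} [Field k] [CharP k p] {d : ℕ} (t : Fin d → k) :
    Prop :=
  LinearIndependent (frobenius k p).fieldRange (fun e : Fin d → Fin p ↦ ∏ j, t j ^ (e j : ℕ)) ∧
    Submodule.span (frobenius k p).fieldRange
      (Set.range fun e : Fin d → Fin p ↦ ∏ j, t j ^ (e j : ℕ)) = ⊤

/-- `K_∞ = K(μ_{p^∞}, t₁^{p^{-∞}}, …, t_d^{p^{-∞}})` inside an algebraic closure `Kbar` of `K`. -/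
def kInfty (p : ℕ) {K : Type*} (Kbar : Type*) [Field K] [Field Kbar] [Algebra K Kbar]
    {d : ℕ} (t : Fin d → K) : IntermediateField K Kbar :=
  IntermediateField.adjoin K
    ({x : Kbar | ∃ n : ℕ, x ^ p ^ n = 1} ∪
      {x : Kbar | ∃ (j : Fin d) (n : ℕ), x ^ p ^ n = algebraMap K Kbar (t j)})

/-- The cyclotomic character `χ : Γ → ℤ_pˣ` of `Γ = Gal(L/K)`, where `L` is an extension of `K` that
contains all `p`-power roots of unity: `γ ζ = ζ ^ χ(γ)` for every `p`-power root of unity `ζ`. -/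
noncomputable def galCyclotomicCharacter (p : ℕ) [Fact p.Prime] (K L : Type*) [Field K] [Field L]
    [Algebra K L] : Gal(L/K) →* ℤ_[p]ˣ :=
  (cyclotomicCharacter L p).comp (MulSemiringAction.toRingAut Gal(L/K) L)

/-- `K_∞` contains all `p`-power roots of unity, so that its cyclotomic character is the genuine
one. -/
theorem galCyclotomicCharacter_kInfty_spec (p : ℕ) [Fact p.Prime] {K : Type*} (Kbar : Type*)
    [Field K] [CharZero K] [Field Kbar] [Algebra K Kbar] [IsAlgClosure K Kbar] {d : ℕ}
    (t : Fin d → K) (γ : Gal(kInfty p Kbar t/K)) (n : ℕ) (ζ : kInfty p Kbar t)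
    (hζ : ζ ^ p ^ n = 1) :
    γ ζ = ζ ^ ((galCyclotomicCharacter p K (kInfty p Kbar t) γ).val.toZModPow n).val := by
  have : IsAlgClosed Kbar := IsAlgClosure.isAlgClosed K
  have : CharZero Kbar := charZero_of_injective_algebraMap (algebraMap K Kbar).injective
  have hroots : ∀ i, HasEnoughRootsOfUnity (kInfty p Kbar t) (p ^ i) := by
    intro i
    have hp : NeZero (p ^ i) := ⟨pow_ne_zero _ (Fact.out : p.Prime).ne_zero⟩
    have hp' : NeZero ((p ^ i : ℕ) : Kbar) := ⟨by exact_mod_cast hp.out⟩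
    obtain ⟨z, hz⟩ := HasEnoughRootsOfUnity.exists_primitiveRoot Kbar (p ^ i)
    have hmem : z ∈ kInfty p Kbar t :=
      IntermediateField.subset_adjoin _ _ (Or.inl ⟨i, hz.pow_eq_one⟩)
    refine ⟨⟨⟨z, hmem⟩, ?_⟩, rootsOfUnity.isCyclic _ _⟩
    exact IsPrimitiveRoot.of_map_of_injective (f := (kInfty p Kbar t).val) (by simpa using hz)
      (kInfty p Kbar t).val.injective
  exact cyclotomicCharacter.spec p (MulSemiringAction.toRingAut _ _ γ) ζ hζ

/-! ### The representations `K[log t]^{<r}` -/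

/-- `log χ(γ)`, as an element of `K ⊇ ℚ_p`. -/
noncomputable def logChi (p : ℕ) [Fact p.Prime] (K L : Type*) [Field K] [Field L]
    [Algebra K L] [Algebra ℚ_[p] K] (γ : Gal(L/K)) : K :=
  algebraMap ℚ_[p] K (padicUnitLog p (galCyclotomicCharacter p K L γ))

/-- `K[log t]^{<r}`: polynomials over `K` of degree `< r` in a variable `X = log t`, on which
`γ ∈ Gal(L/K)` acts by `f(X) ↦ f(X + log χ(γ))`. -/
noncomputable def logTRep (p : ℕ) [Fact p.Prime] (K L : Type*) [Field K] [Field L]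
    [Algebra K L] [Algebra ℚ_[p] K] (r : ℕ) :
    Representation K Gal(L/K) (Polynomial.degreeLT K r) where
  toFun γ := (Polynomial.taylor (logChi p K L γ)).restrict fun f hf ↦ by
    rw [Polynomial.mem_degreeLT] at hf ⊢
    rwa [Polynomial.degree_taylor]
  map_one' := by
    ext1 f
    apply Subtype.ext
    simp [LinearMap.restrict_apply, logChi, padicUnitLog_one]
  map_mul' γ γ' := by
    ext1 f
    apply Subtype.ext
    simp [LinearMap.restrict_apply, logChi, padicUnitLog_mul, Polynomial.taylor_taylor]

theorem logTRep_apply_coe (p : ℕ) [Fact p.Prime] (K L : Type*) [Field K] [Field L]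
    [Algebra K L] [Algebra ℚ_[p] K] (r : ℕ) (γ : Gal(L/K)) (f : Polynomial.degreeLT K r) :
    (logTRep p K L r γ f : K[X]) =
      (f : K[X]).comp (Polynomial.X + Polynomial.C (logChi p K L γ)) :=
  rfl

/-! ### Jordan–Hölder factors -/

/-- All Jordan–Hölder factors of `ρ` are isomorphic to the one-dimensional trivial representation:
`ρ`, seen as a `K[G]`-module, has a composition series from `0` to `V` (a chain of `G`-stable
subspaces with irreducible successive quotients) all of whose successive quotients are isomorphic to
`K` with the trivial action. By the Jordan–Hölder theorem the choice of the series is immaterial. -/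
def AllJordanHolderFactorsTrivial {K G V : Type*} [Field K] [Group G] [AddCommGroup V]
    [Module K V] (ρ : Representation K G V) : Prop :=
  ∃ s : CompositionSeries (Submodule K[G] ρ.asModule), s.head = ⊥ ∧ s.last = ⊤ ∧
    ∀ i : Fin s.length,
      Nonempty ((s i.succ ⧸ (s i.castSucc).submoduleOf (s i.succ)) ≃ₗ[K[G]]
        (Representation.trivial K G K).asModule)

/-! Trivial Jordan–Hölder factors make every ρ(γ) unipotent. The heart of the matter is that a
continuous unipotent action of Γ factors through ℓ = log χ. If χ(h) = 1, Kummer theory gives g h g⁻¹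
= h^χ(g) (`tendsto_pow_appr_conj`). Let B = (ρ(h) - 1)^j be the last nonzero power; conjugation by
ρ(g) multiplies B by χ(g)^j. When ℓ(g) ≠ 0 this scalar is not 1 for j > 0, which unipotence of ρ(g)
forbids; so ρ(h) = 1 (`map_eq_one_of_tendsto_pow`). If only ℓ(h) = 0, a power of h lies in ker χ,
and unipotents are torsion-free in characteristic 0.

A g with ℓ(g) ≠ 0 exists because K is discretely valued: otherwise χ has finite image, and partial
norms of 1 - ζ, with ζ of order p^(n+1), would give elements of K of arbitrarily small positive
valuation.

Compactness of Γ then yields ρ(γ) = exp(ℓ(γ) N) with N nilpotent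
(`exists_eq_sum_smul_pow_of_unipotent`). By the structure theorem over K[X], N is a sum of copies of
d/dX on polynomials of bounded degree, and exp(a d/dX) is translation by a, which is the action on
K[log t]^{<r}. -/

/-! ### Size, kernel and continuity of the p-adic logarithm. -/

section PadicLogNorm

variable {p : ℕ} [Fact p.Prime]

theorem padic_norm_pow_sub_one_le {v : ℚ_[p]} (hv : ‖v‖ ≤ 1) (i : ℕ) :
    ‖v ^ i - 1‖ ≤ ‖v - 1‖ := by
  rw [← mul_geom_sum, norm_mul]
  refine mul_le_of_le_one_right (norm_nonneg _) ?_
  refine IsUltrametricDist.norm_sum_le_of_forall_le_of_nonneg zero_le_one fun j _ ↦ ?_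
  rw [norm_pow]
  exact pow_le_one₀ (norm_nonneg _) hv

theorem padic_norm_le_one_of_norm_sub_one_lt {v : ℚ_[p]} (hv : ‖v - 1‖ < ‖(p : ℚ_[p])‖) :
    ‖v‖ ≤ 1 := by
  have h : v = (v - 1) + 1 := by ring
  rw [h]
  refine (Padic.nonarchimedean _ _).trans (max_le (hv.le.trans Padic.norm_p_lt_one.le) ?_)
  simp

/-- The cofactor ∑ v^i of v - 1 is congruent to p modulo v - 1, which is smaller than p, so it has
norm |p|. -/
theorem padic_norm_pow_prime_sub_one {v : ℚ_[p]} (hv : ‖v - 1‖ < ‖(p : ℚ_[p])‖) :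
    ‖v ^ p - 1‖ = ‖v - 1‖ * ‖(p : ℚ_[p])‖ := by
  rw [← mul_geom_sum, norm_mul]
  congr 1
  refine Padic.norm_eq_of_norm_sub_lt_right (lt_of_le_of_lt ?_ hv)
  have h : ∑ i ∈ Finset.range p, v ^ i - (p : ℚ_[p]) = ∑ i ∈ Finset.range p, (v ^ i - 1) := by
    simp
  rw [h]
  exact IsUltrametricDist.norm_sum_le_of_forall_le_of_nonneg (norm_nonneg _) fun i _ ↦
    padic_norm_pow_sub_one_le (padic_norm_le_one_of_norm_sub_one_lt hv) i

theorem padic_norm_pow_prime_pow_sub_one {v : ℚ_[p]} (hv : ‖v - 1‖ < ‖(p : ℚ_[p])‖) (N : ℕ) :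
    ‖v ^ p ^ N - 1‖ = ‖v - 1‖ * ‖(p : ℚ_[p])‖ ^ N := by
  induction N with
  | zero => simp
  | succ N ih =>
    have h : ‖v ^ p ^ N - 1‖ < ‖(p : ℚ_[p])‖ :=
      (padic_norm_pow_sub_one_le (padic_norm_le_one_of_norm_sub_one_lt hv) _).trans_lt hv
    rw [pow_succ p, pow_mul, padic_norm_pow_prime_sub_one h, ih, pow_succ, mul_assoc]

/-- The `p`-adic logarithm is an isometry near `1`. -/
theorem norm_padicLogOneAdd {x : ℚ_[p]} (hx : ‖x‖ < ‖(p : ℚ_[p])‖) :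
    ‖padicLogOneAdd p x‖ = ‖x‖ := by
  refine tendsto_nhds_unique
    (padicLogOneAdd_tendsto x (hx.trans Padic.norm_p_lt_one)).norm ?_
  refine tendsto_const_nhds.congr fun N ↦ ?_
  have hp0 : (p : ℚ_[p]) ≠ 0 := by exact_mod_cast (Fact.out : p.Prime).ne_zero
  have h := padic_norm_pow_prime_pow_sub_one (v := 1 + x) (by simpa using hx) N
  rw [norm_div, norm_pow, h, mul_div_cancel_right₀ _ (pow_ne_zero _ (norm_ne_zero_iff.2 hp0))]
  simp

theorem padicUnitLog_pow (u : ℤ_[p]ˣ) (n : ℕ) :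
    padicUnitLog p (u ^ n) = n * padicUnitLog p u := by
  induction n with
  | zero => simp [padicUnitLog_one]
  | succ n ih => rw [pow_succ, padicUnitLog_mul, ih]; push_cast; ring

theorem padicUnitLog_inv (u : ℤ_[p]ˣ) : padicUnitLog p u⁻¹ = -padicUnitLog p u := by
  have h := padicUnitLog_mul u u⁻¹
  rw [mul_inv_cancel, padicUnitLog_one] at h
  exact (neg_eq_of_add_eq_zero_right h.symm).symm

/-- The (p-1)-th power is 1 mod p, and the further p-th power makes it 1 mod p². This reaches the
disc where log is an isometry, also for p = 2. -/
theorem padicInt_unit_norm_pow_sub_one_lt (u : ℤ_[p]ˣ) :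
    ‖((u : ℤ_[p]) : ℚ_[p]) ^ ((p - 1) * p) - 1‖ < ‖(p : ℚ_[p])‖ := by
  have h : (p : ℤ_[p]) ∣ (u : ℤ_[p]) ^ (p - 1) - 1 := by
    rw [← PadicInt.norm_lt_one_iff_dvd, PadicInt.norm_def]
    push_cast
    exact padicInt_unit_pow_sub_one_norm_lt u
  obtain ⟨c, hc⟩ := dvd_sub_pow_of_dvd_sub h 1
  rw [one_pow, pow_one, ← pow_mul] at hc
  have hc' := congrArg (fun z : ℤ_[p] ↦ ‖(z : ℚ_[p])‖) hc
  push_cast at hc'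
  rw [hc', norm_mul, norm_pow]
  have h1 : ‖(c : ℚ_[p])‖ ≤ 1 := c.2
  have h2 := Padic.norm_p_lt_one (p := p)
  have h3 : 0 < ‖(p : ℚ_[p])‖ :=
    norm_pos_iff.2 (by exact_mod_cast (Fact.out : p.Prime).ne_zero)
  nlinarith [mul_pos h3 h3]

/-- Compute log(u^p) = p log u in the isometry disc. The formula gives both the kernel and the
continuity of log. -/
theorem norm_padicUnitLog (u : ℤ_[p]ˣ) :
    ‖padicUnitLog p u‖ * ‖(p : ℚ_[p])‖ = ‖((u : ℤ_[p]) : ℚ_[p]) ^ ((p - 1) * p) - 1‖ := by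
  have h1 : ‖((p : ℚ_[p]) - 1)‖ = 1 := by
    have h := Padic.norm_eq_of_norm_sub_lt_right (p := p) (z1 := p - 1) (z2 := -1)
      (by simpa using Padic.norm_p_lt_one (p := p))
    simpa using h
  rw [mul_comm, ← norm_mul, ← padicUnitLog_pow, padicUnitLog, norm_mul, norm_inv, h1, inv_one,
    one_mul]
  have h2 : (((u ^ p : ℤ_[p]ˣ) : ℤ_[p]) : ℚ_[p]) ^ (p - 1) - 1 =
      ((u : ℤ_[p]) : ℚ_[p]) ^ ((p - 1) * p) - 1 := by
    push_cast
    rw [← pow_mul, mul_comm]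
  rw [h2]
  exact norm_padicLogOneAdd (padicInt_unit_norm_pow_sub_one_lt u)

theorem pow_eq_one_of_padicUnitLog_eq_zero {u : ℤ_[p]ˣ} (hu : padicUnitLog p u = 0) :
    u ^ ((p - 1) * p) = 1 := by
  have h := norm_padicUnitLog u
  rw [hu, norm_zero, zero_mul, eq_comm, norm_eq_zero, sub_eq_zero] at h
  exact Units.ext (PadicInt.ext (by push_cast; exact h))

theorem continuous_padicUnitLog : Continuous (padicUnitLog p) := by
  rw [continuous_iff_continuousAt]
  intro v
  rw [ContinuousAt, tendsto_iff_norm_sub_tendsto_zero]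
  have hp0 : ‖(p : ℚ_[p])‖ ≠ 0 :=
    norm_ne_zero_iff.2 (by exact_mod_cast (Fact.out : p.Prime).ne_zero)
  have h (u : ℤ_[p]ˣ) : ‖padicUnitLog p u - padicUnitLog p v‖ =
      ‖(((u * v⁻¹ : ℤ_[p]ˣ) : ℤ_[p]) : ℚ_[p]) ^ ((p - 1) * p) - 1‖ / ‖(p : ℚ_[p])‖ := by
    rw [eq_div_iff hp0, ← norm_padicUnitLog, padicUnitLog_mul, padicUnitLog_inv, sub_eq_add_neg]
  simp_rw [h]
  have hc : Continuous fun u : ℤ_[p]ˣ ↦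
      ‖(((u * v⁻¹ : ℤ_[p]ˣ) : ℤ_[p]) : ℚ_[p]) ^ ((p - 1) * p) - 1‖ / ‖(p : ℚ_[p])‖ := by
    have h1 : Continuous fun u : ℤ_[p]ˣ ↦ (((u * v⁻¹ : ℤ_[p]ˣ) : ℤ_[p]) : ℚ_[p]) :=
      (continuous_subtype_val (p := fun x : ℚ_[p] ↦ ‖x‖ ≤ 1)).comp
        ((Units.continuous_val (M := ℤ_[p])).comp (continuous_mul_const _))
    fun_prop
  have := hc.tendsto v
  simpa using this

end PadicLogNorm

/-! ### Divisibility between p and 1 - η for p-power roots of unity η. -/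

section PrimitiveRoots

variable {p : ℕ} [Fact p.Prime] {L : Type*} [Field L]

/-- Evaluate the cyclotomic polynomial at 1: p = ∏ (1 - μ), and each μ is a power of η, so 1 - η
divides 1 - μ. -/
theorem IsPrimitiveRoot.exists_isIntegral_prime_eq {n : ℕ} {η : L}
    (hη : IsPrimitiveRoot η (p ^ (n + 1))) :
    ∃ c : L, IsIntegral ℤ c ∧ (p : L) = (1 - η) ^ (p ^ (n + 1)).totient * c := by
  have hpos : 0 < p ^ (n + 1) := pow_pos (Fact.out : p.Prime).pos _
  have hint : IsIntegral ℤ η := hη.isIntegral hpos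
  have h (μ : L) (hμ : μ ∈ primitiveRoots (p ^ (n + 1)) L) :
      ∃ c : L, IsIntegral ℤ c ∧ 1 - μ = (1 - η) * c := by
    obtain ⟨i, -, rfl⟩ := hη.eq_pow_of_pow_eq_one ((mem_primitiveRoots hpos).1 hμ).pow_eq_one
    refine ⟨∑ j ∈ Finset.range i, η ^ j, IsIntegral.sum _ fun j _ ↦ hint.pow j, ?_⟩
    rw [mul_neg_geom_sum]
  choose! c hc hc' using h
  refine ⟨∏ μ ∈ primitiveRoots (p ^ (n + 1)) L, c μ, IsIntegral.prod _ hc, ?_⟩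
  have h1 : (p : L) = ∏ μ ∈ primitiveRoots (p ^ (n + 1)) L, (1 - μ) := by
    rw [← Polynomial.eval_one_cyclotomic_prime_pow (R := L) (p := p) n,
      Polynomial.cyclotomic_eq_prod_X_sub_primitiveRoots hη, Polynomial.eval_prod]
    simp
  rw [h1, Finset.prod_congr rfl hc', Finset.prod_mul_distrib, Finset.prod_const,
    hη.card_primitiveRoots]

/-- Frobenius is additive modulo p; apply it to (1 - η) + η = 1. -/
theorem exists_isIntegral_one_sub_pow_eq {n : ℕ} {η : L} (hη : η ^ p ^ n = 1) :
    ∃ c : L, IsIntegral ℤ c ∧ (1 - η) ^ p ^ n = p * c := by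
  have hpos : 0 < p ^ n := pow_pos (Fact.out : p.Prime).pos _
  have hint : IsIntegral ℤ η := IsIntegral.of_pow hpos (by rw [hη]; exact isIntegral_one)
  obtain ⟨r, hr⟩ := exists_add_pow_prime_pow_eq (Fact.out : p.Prime)
    (1 - ⟨η, hint⟩ : integralClosure ℤ L) ⟨η, hint⟩ n
  have hr' := congrArg (Subtype.val : integralClosure ℤ L → L) hr
  push_cast at hr'
  rw [sub_add_cancel, one_pow, hη] at hr'
  refine ⟨-((1 - η) * η * r), ?_, ?_⟩
  · exact (((isIntegral_one.sub hint).mul hint).mul r.2).neg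
  · linear_combination -hr'

end PrimitiveRoots

/-! ### Exponentials and logarithms of nilpotents. -/

section NilpotentExp

theorem IsNilpotent.exists_exp_eq_add_sq {A : Type*} [CommRing A] [Algebra ℚ A] {x : A}
    (hx : IsNilpotent x) : ∃ c, IsNilpotent.exp x = 1 + x + x ^ 2 * c := by
  obtain ⟨n, hn⟩ := hx
  have hn' : x ^ (n + 2) = 0 := by rw [pow_add, hn, zero_mul]
  refine ⟨∑ i ∈ Finset.range n, ((i + 2).factorial : ℚ)⁻¹ • x ^ i, ?_⟩
  rw [IsNilpotent.exp_eq_sum hn', Finset.sum_range_succ', Finset.sum_range_succ', Finset.mul_sum]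
  simp only [mul_smul_comm, ← pow_add, add_comm 2]
  simp [add_assoc, add_comm, add_left_comm]

/-- Successive approximation: dividing 1 + x by exp x leaves 1 plus a multiple of x², whose
nilpotency index is smaller. -/
theorem exists_isNilpotent_exp_eq_one_add_of_pow_eq_zero {A : Type*} [CommRing A] [Algebra ℚ A]
    (n : ℕ) : ∀ x : A, x ^ n = 0 → ∃ y, IsNilpotent y ∧ IsNilpotent.exp y = 1 + x := by
  induction n using Nat.strong_induction_on with
  | h n ih =>
    intro x hx
    rcases lt_or_ge n 2 with hn | hn
    · have h0 : x = 0 := by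
        rw [← pow_one x]
        exact pow_eq_zero_of_le (by omega) hx
      exact ⟨0, IsNilpotent.zero, by rw [h0, IsNilpotent.exp_zero, add_zero]⟩
    · have hnil : IsNilpotent x := ⟨n, hx⟩
      obtain ⟨c, hc⟩ := hnil.neg.exists_exp_eq_add_sq
      have e : 1 + x ^ 2 * (c * (1 + x) - 1) = IsNilpotent.exp (-x) * (1 + x) := by
        rw [hc]; ring
      obtain ⟨y, hy, hy'⟩ := ih (n - 1) (by omega) (x ^ 2 * (c * (1 + x) - 1)) (by
        rw [mul_pow, ← pow_mul, pow_eq_zero_of_le (by omega) hx, zero_mul])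
      refine ⟨x + y, (Commute.all x y).isNilpotent_add hnil hy, ?_⟩
      rw [IsNilpotent.exp_add_of_commute (Commute.all _ _) hnil hy, hy', e, ← mul_assoc,
        IsNilpotent.exp_mul_exp_neg_self hnil, one_mul]

/-- Every unipotent element of a `ℚ`-algebra is the exponential of a nilpotent element. -/
theorem IsNilpotent.exists_exp_eq_one_add {A : Type*} [Ring A] [Algebra ℚ A] {a : A}
    (ha : IsNilpotent a) : ∃ y, IsNilpotent y ∧ IsNilpotent.exp y = 1 + a := by
  obtain ⟨n, hn⟩ := ha
  -- The commutative case applies in ℚ[X]/(X^n), which maps to A by X ↦ a.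
  let I : Ideal ℚ[X] := Ideal.span {Polynomial.X ^ n}
  let f : ℚ[X] ⧸ I →ₐ[ℚ] A := Ideal.Quotient.liftₐ I (Polynomial.aeval a) fun q hq ↦ by
    obtain ⟨r, rfl⟩ := Ideal.mem_span_singleton'.1 hq
    simp [hn]
  have hf : f (Ideal.Quotient.mk I Polynomial.X) = a := by
    exact (Ideal.Quotient.lift_mk I _ _).trans (Polynomial.aeval_X a)
  obtain ⟨y, hy, hy'⟩ := exists_isNilpotent_exp_eq_one_add_of_pow_eq_zero n
    (Ideal.Quotient.mk I Polynomial.X) (by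
      rw [← map_pow]
      exact Ideal.Quotient.eq_zero_iff_mem.2 (Ideal.mem_span_singleton_self _))
  refine ⟨f y, hy.map f, ?_⟩
  rw [← IsNilpotent.map_exp hy f, hy', map_add, map_one, hf]

theorem IsNilpotent.exp_nsmul {A : Type*} [Ring A] [Module ℚ A] {a : A}
    (ha : IsNilpotent a) (n : ℕ) : IsNilpotent.exp (n • a) = IsNilpotent.exp a ^ n := by
  induction n with
  | zero => simp
  | succ n ih =>
    rw [succ_nsmul, IsNilpotent.exp_add_of_commute
      ((Commute.refl a).smul_left n) (ha.smul n) ha, ih, _root_.pow_succ]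

end NilpotentExp

/-! ### Translation of polynomials as exp(a d/dX). -/

section Taylor

theorem Polynomial.taylor_eq_sum_smul_iterate_derivative {K : Type*} [Field K] [CharZero K]
    (a : K) {n : ℕ} {f : K[X]} (hf : f.natDegree < n) :
    taylor a f = ∑ i ∈ Finset.range n, ((i.factorial : K)⁻¹ * a ^ i) • (derivative^[i] f) := by
  have h (i : ℕ) : ((i.factorial : K)⁻¹ * a ^ i) • (derivative^[i] f) = a ^ i • hasseDeriv i f := by
    rw [← factorial_smul_hasseDeriv, LinearMap.smul_apply, ← Nat.cast_smul_eq_nsmul K, smul_smul,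
      mul_right_comm, inv_mul_cancel₀ (by exact_mod_cast i.factorial_ne_zero), one_mul]
  simp_rw [h]
  have key (m : ℕ) (hm : m < n) (c : K) :
      taylor a (monomial m c) = ∑ i ∈ Finset.range n, a ^ i • hasseDeriv i (monomial m c) := by
    rw [taylor_monomial, add_comm, add_pow,
      Finset.sum_subset (Finset.range_mono (Nat.succ_le_of_lt hm)), Finset.mul_sum]
    · refine Finset.sum_congr rfl fun i _ ↦ ?_
      rw [hasseDeriv_monomial, smul_monomial, ← C_mul_X_pow_eq_monomial, ← C_pow]
      simp only [smul_eq_mul, C_mul, map_natCast]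
      ring
    · intro i _ hi
      rw [Nat.choose_eq_zero_of_lt (by simpa using hi)]
      simp
  rw [f.as_sum_range, map_sum]
  simp_rw [map_sum, Finset.smul_sum]
  rw [Finset.sum_comm]
  exact Finset.sum_congr rfl fun m hm ↦ key m (by have := Finset.mem_range.1 hm; omega) _

end Taylor

/-! ### Normal form of a nilpotent endomorphism. -/

section NilpotentNormalForm

open Polynomial Module

variable {K : Type*} [Field K]

/-- Applying f(d/dX) to X^n reverses the coefficients of f, up to factors that are nonzero in
characteristic 0. Hence X^n is a cyclic vector for d/dX in degree ≤ n, with annihilator (X^(n+1)).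
-/
theorem coeff_aeval_derivative_X_pow (n : ℕ) (f : K[X]) {j : ℕ} (hj : j ≤ n) :
    (aeval (derivative : End K K[X]) f (X ^ n)).coeff j =
      f.coeff (n - j) * (n.descFactorial (n - j) : K) := by
  induction f using Polynomial.induction_on' with
  | add f g hf hg => simp [hf, hg, add_mul]
  | monomial i c =>
    rw [aeval_monomial, coeff_monomial, Module.End.mul_apply, Module.algebraMap_end_apply,
      Module.End.pow_apply, iterate_derivative_X_pow_eq_smul, coeff_smul, coeff_smul, coeff_X_pow]
    split_ifs with h1 h2 h2
    · subst h2; simp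
    · rw [Nat.descFactorial_eq_zero_iff_lt.2 (by omega)]; simp
    · omega
    · simp

theorem aeval_derivative_X_pow_mem_degreeLT (n : ℕ) (f : K[X]) :
    aeval (derivative : End K K[X]) f (X ^ n) ∈ degreeLT K (n + 1) := by
  induction f using Polynomial.induction_on' with
  | add f g hf hg => simpa using add_mem hf hg
  | monomial i c =>
    rw [aeval_monomial, Module.End.mul_apply, Module.algebraMap_end_apply,
      Module.End.pow_apply, iterate_derivative_X_pow_eq_smul]
    refine Submodule.smul_mem _ _ (Submodule.smul_of_tower_mem _ _ ?_)
    rw [mem_degreeLT]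
    exact (degree_X_pow_le _).trans_lt (by exact_mod_cast (by omega : n - i < n + 1))

theorem aeval_derivative_X_pow_eq_zero_iff [CharZero K] (n : ℕ) (f : K[X]) :
    aeval (derivative : End K K[X]) f (X ^ n) = 0 ↔ X ^ (n + 1) ∣ f := by
  constructor
  · intro h
    rw [X_pow_dvd_iff]
    intro i hi
    have h1 := coeff_aeval_derivative_X_pow n f (Nat.sub_le n i)
    rw [h, coeff_zero, eq_comm, mul_eq_zero, Nat.cast_eq_zero, Nat.descFactorial_eq_zero_iff_lt,
      Nat.sub_sub_self (by omega)] at h1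
    exact h1.resolve_right (by omega)
  · rintro ⟨g, rfl⟩
    rw [mul_comm, map_mul, Module.End.mul_apply, map_pow (aeval (derivative : End K K[X])), aeval_X,
      Module.End.pow_apply, iterate_derivative_X_pow_eq_smul, Nat.descFactorial_eq_zero_iff_lt.2 (by omega), Nat.cast_zero,
      zero_smul, map_zero]

theorem exists_aeval_derivative_X_pow_eq [CharZero K] (n : ℕ) {g : K[X]}
    (hg : g ∈ degreeLT K (n + 1)) :
    ∃ f : K[X], aeval (derivative : End K K[X]) f (X ^ n) = g := by
  refine ⟨∑ j ∈ Finset.range (n + 1),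
    monomial (n - j) (g.coeff j * (n.descFactorial (n - j) : K)⁻¹), ?_⟩
  ext j
  rcases le_or_gt j n with hj | hj
  · rw [coeff_aeval_derivative_X_pow n _ hj, finsetSum_coeff, Finset.sum_eq_single j]
    · have h0 : (n.descFactorial (n - j) : K) ≠ 0 := by
        rw [Nat.cast_ne_zero, Ne, Nat.descFactorial_eq_zero_iff_lt]
        omega
      rw [coeff_monomial_same, inv_mul_cancel_right₀ h0]
    · intro i hi hij
      have := Finset.mem_range.1 hi
      rw [coeff_monomial, if_neg (by omega)]
    · intro h
      exact absurd (Finset.mem_range.2 (by omega)) h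
  · have h (q : K[X]) (hq : q ∈ degreeLT K (n + 1)) : q.coeff j = 0 :=
      coeff_eq_zero_of_degree_lt ((mem_degreeLT.1 hq).trans_le (by exact_mod_cast hj))
    rw [h _ (aeval_derivative_X_pow_mem_degreeLT n _), h _ hg]

/-- `K[X] / (X ^ r)`, with multiplication by `X`, is isomorphic to the polynomials of degree `< r`,
with the derivative. -/
theorem exists_quotient_X_pow_equiv_degreeLT [CharZero K] {r : ℕ} (hr : 0 < r) :
    ∃ e : (K[X] ⧸ K[X] ∙ (X ^ r : K[X])) ≃ₗ[K] degreeLT K r,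
      ∀ q, (e ((X : K[X]) • q) : K[X]) = derivative (e q : K[X]) := by
  obtain ⟨n, rfl⟩ : ∃ n, r = n + 1 := ⟨r - 1, by omega⟩
  let D : End K K[X] := derivative
  let S : K[X] →ₗ[K[X]] AEval' D := LinearMap.toSpanSingleton K[X] _ (AEval'.of D (X ^ n))
  have hS (f : K[X]) : S f = AEval'.of D (aeval D f (X ^ n)) := by
    rw [LinearMap.toSpanSingleton_apply, ← AEval.of_aeval_smul]
    rfl
  have hker : LinearMap.ker S = K[X] ∙ (X ^ (n + 1) : K[X]) := by
    ext f
    rw [LinearMap.mem_ker, hS, LinearEquiv.map_eq_zero_iff, aeval_derivative_X_pow_eq_zero_iff]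
    exact Ideal.mem_span_singleton.symm
  let T : (K[X] ⧸ K[X] ∙ (X ^ (n + 1) : K[X])) →ₗ[K[X]] AEval' D :=
    Submodule.liftQ _ S hker.ge
  have hT : Function.Injective T := by
    rw [← LinearMap.ker_eq_bot]
    exact Submodule.ker_liftQ_eq_bot _ _ _ hker.le
  have hTmk (f : K[X]) : T (Submodule.Quotient.mk f) = AEval'.of D (aeval D f (X ^ n)) :=
    (Submodule.liftQ_apply _ _ _).trans (hS f)
  let T' : (K[X] ⧸ K[X] ∙ (X ^ (n + 1) : K[X])) →ₗ[K] degreeLT K (n + 1) :=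
    LinearMap.codRestrict _ ((AEval'.of D).symm.toLinearMap ∘ₗ T.restrictScalars K) fun q ↦ by
      induction q using Submodule.Quotient.induction_on with
      | H f =>
        change (AEval'.of D).symm (T (Submodule.Quotient.mk f)) ∈ _
        rw [hTmk, LinearEquiv.symm_apply_apply]
        exact aeval_derivative_X_pow_mem_degreeLT n f
  have hT' (q) : (T' q : K[X]) = (AEval'.of D).symm (T q) := rfl
  refine ⟨LinearEquiv.ofBijective T' ⟨fun a b hab ↦ hT ((AEval'.of D).symm.injective ?_), ?_⟩, ?_⟩
  · rw [← hT', ← hT', hab]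
  · intro g
    obtain ⟨f, hf⟩ := exists_aeval_derivative_X_pow_eq n g.2
    refine ⟨Submodule.Quotient.mk f, Subtype.ext ?_⟩
    rw [hT', hTmk, LinearEquiv.symm_apply_apply]
    exact hf
  · intro q
    change (T' ((X : K[X]) • q) : K[X]) = derivative (T' q : K[X])
    rw [hT', hT', map_smul, AEval'.of_symm_X_smul]

/-- Subsingleton factors can be dropped from a product. -/
theorem exists_pi_linearEquiv_of_subsingleton {K : Type*} [Semiring K] {d : ℕ} (P : Fin d → Prop)
    (M : Fin d → Type*) [∀ i, AddCommMonoid (M i)] [∀ i, Module K (M i)]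
    (hM : ∀ i, ¬ P i → Subsingleton (M i)) :
    ∃ (k : ℕ) (f : Fin k → Fin d), (∀ j, P (f j)) ∧
      ∃ e : (∀ i, M i) ≃ₗ[K] ∀ j, M (f j), ∀ x j, e x j = x (f j) := by
  classical
  let g := (Fintype.equivFin {i // P i}).symm
  refine ⟨_, fun j ↦ (g j : Fin d), fun j ↦ (g j).2, LinearEquiv.ofBijective
    (LinearMap.pi fun j ↦ LinearMap.proj (g j : Fin d)) ⟨fun x y hxy ↦ ?_, fun y ↦ ?_⟩,
    fun x j ↦ rfl⟩
  · funext i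
    by_cases hi : P i
    · have h : ∀ s : {i // P i}, x s = y s := fun s ↦ by
        obtain ⟨j, rfl⟩ := g.surjective s
        exact congrFun hxy j
      exact h ⟨i, hi⟩
    · exact (hM i hi).elim _ _
  · have hy : ∃ z : ∀ s : {i // P i}, M s, ∀ j, z (g j) = y j :=
      ⟨(Equiv.piCongrLeft (fun s : {i // P i} ↦ M s) g) y,
        fun j ↦ Equiv.piCongrLeft_apply_apply (P := fun s : {i // P i} ↦ M s) g y j⟩
    obtain ⟨z, hz⟩ := hy
    refine ⟨fun i ↦ if h : P i then z ⟨i, h⟩ else 0, ?_⟩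
    funext j
    simp [(g j).2, hz]

/-- The normal form of a nilpotent endomorphism in characteristic `0`: it is a direct sum of the
derivatives on spaces of polynomials of bounded degree. -/
theorem exists_linearEquiv_directSum_degreeLT [CharZero K] {V : Type*} [AddCommGroup V]
    [Module K V] [FiniteDimensional K V] (N : End K V) (hN : IsNilpotent N) :
    ∃ (k : ℕ) (r : Fin k → ℕ), (∀ i, 0 < r i) ∧ ∃ e : V ≃ₗ[K] ⨁ i, degreeLT K (r i),
      ∀ v i, (e (N v) i : K[X]) = derivative (e v i : K[X]) := by
  obtain ⟨n, hn⟩ := hN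
  have htors : Module.IsTorsion' (AEval' N) (Submonoid.powers (X : K[X])) := by
    intro x
    refine ⟨⟨X ^ n, n, rfl⟩, ?_⟩
    obtain ⟨v, rfl⟩ := (AEval'.of N).surjective x
    change (X ^ n : K[X]) • AEval'.of N v = 0
    rw [AEval'.X_pow_smul_of, hn, zero_smul, map_zero]
  have : Module.Finite K (AEval' N) := Module.Finite.equiv (AEval'.of N)
  have : Module.Finite K[X] (AEval' N) := Module.Finite.of_restrictScalars_finite K _ _
  obtain ⟨d, s, ⟨E⟩⟩ := Module.torsion_by_prime_power_decomposition
    (prime_X (R := K)).irreducible htors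
  -- The decomposition may contain exponents s i = 0; these zero summands are dropped to get all r >
  -- 0.
  obtain ⟨k, f, hf, F, hF⟩ := exists_pi_linearEquiv_of_subsingleton (K := K[X])
    (fun i ↦ 0 < s i) (fun i ↦ K[X] ⧸ K[X] ∙ (X ^ s i : K[X])) fun i hi ↦ by
      rw [Submodule.Quotient.subsingleton_iff, show s i = 0 by omega, pow_zero]
      exact Ideal.span_singleton_one
  choose G hG using fun j ↦ exists_quotient_X_pow_equiv_degreeLT (K := K) (hf j)
  let e₁ : V ≃ₗ[K] ∀ j, K[X] ⧸ K[X] ∙ (X ^ s (f j) : K[X]) := (AEval'.of N).trans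
    ((E.trans ((DirectSum.linearEquivFunOnFintype K[X] _ _).trans F)).restrictScalars K)
  have he₁ (v : V) : e₁ (N v) = (X : K[X]) • e₁ v := by
    change (E.trans ((DirectSum.linearEquivFunOnFintype K[X] _ _).trans F)) (AEval'.of N (N v)) =
      (X : K[X]) • (E.trans ((DirectSum.linearEquivFunOnFintype K[X] _ _).trans F)) (AEval'.of N v)
    rw [← AEval'.X_smul_of, map_smul]
  refine ⟨k, fun j ↦ s (f j), hf, (e₁.trans (LinearEquiv.piCongrRight G)).trans
    (DirectSum.linearEquivFunOnFintype K (Fin k) fun j ↦ degreeLT K (s (f j))).symm, ?_⟩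
  have happ (v : V) (j) : ((e₁.trans (LinearEquiv.piCongrRight G)).trans
    (DirectSum.linearEquivFunOnFintype K (Fin k) fun j ↦ degreeLT K (s (f j))).symm) v j =
      G j (e₁ v j) := rfl
  intro v j
  rw [happ, happ, he₁]
  exact hG j _

end NilpotentNormalForm

/-! ### Rigidity of unipotent elements. -/

section Unipotent

/-- Write (1 + M)^n - 1 = M G. Since M^(j+1) = 0, multiplying M^j by G is multiplying it by n. -/
theorem one_add_pow_sub_one_pow {R : Type*} [Ring R] {M : R} {j : ℕ} (hM : M ^ (j + 1) = 0)
    (n : ℕ) : ((1 + M) ^ n - 1) ^ j = n ^ j * M ^ j := by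
  set G : R := ∑ i ∈ Finset.range n, (1 + M) ^ i with hG
  have h1 : (1 + M) ^ n - 1 = M * G := by
    rw [hG, ← mul_geom_sum, add_sub_cancel_left]
  have hcomm : Commute M G := Commute.sum_right _ _ _ fun i _ ↦
    ((Commute.one_right M).add_right (Commute.refl M)).pow_right i
  have h2 (i : ℕ) : M ^ j * (1 + M) ^ i = M ^ j := by
    induction i with
    | zero => simp
    | succ i ih => rw [pow_succ, ← mul_assoc, ih, mul_add, mul_one, ← pow_succ, hM, add_zero]
  have h3 : M ^ j * G = n * M ^ j := by
    simp [hG, Finset.mul_sum, h2]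
  have h4 (k : ℕ) : M ^ j * G ^ k = n ^ k * M ^ j := by
    induction k with
    | zero => simp
    | succ k ih => rw [pow_succ, ← mul_assoc, ih, mul_assoc, h3, ← mul_assoc, ← pow_succ]
  rw [h1, hcomm.mul_pow, h4]

theorem eq_one_of_isNilpotent_sub_one_of_pow_eq_one {R : Type*} [Ring R] [Algebra ℚ R] {u : R}
    (hu : IsNilpotent (u - 1)) {n : ℕ} (hn : n ≠ 0) (h : u ^ n = 1) : u = 1 := by
  by_contra hne
  obtain ⟨j, hj⟩ : ∃ j, nilpotencyClass (u - 1) = j + 1 :=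
    Nat.exists_eq_succ_of_ne_zero fun h0 ↦ hne <| sub_eq_zero.1 <| by
      have := pow_nilpotencyClass hu
      rw [h0, pow_zero] at this
      rw [← mul_one (u - 1), this, mul_zero]
  obtain ⟨h1, h2⟩ := (nilpotencyClass_eq_succ_iff (k := j)).1 hj
  have hj0 : j ≠ 0 := by
    rintro rfl
    rw [zero_add, pow_one] at h1
    exact hne (sub_eq_zero.1 h1)
  have h3 := one_add_pow_sub_one_pow h1 n
  rw [add_sub_cancel, h, sub_self, zero_pow hj0] at h3
  have hunit : IsUnit ((n : R) ^ j) := by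
    have h4 : IsUnit (algebraMap ℚ R n) := (IsUnit.mk0 (n : ℚ) (by exact_mod_cast hn)).map _
    rw [map_natCast] at h4
    exact h4.pow j
  exact h2 ((hunit.mul_right_eq_zero).1 h3.symm)

/-- The relation reads (g - c) B = B · c(g - 1). Iterating, (g - c)^k B = 0 for large k, while g - c
= (1 - c) + (g - 1) is a unit. -/
theorem eq_zero_of_mul_eq_smul_mul {K R : Type*} [Field K] [Ring R] [Algebra K R] {g B : R}
    {c : K} (hc : c ≠ 1) (hg : IsNilpotent (g - 1)) (h : g * B = c • (B * g)) : B = 0 := by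
  obtain ⟨k, hk⟩ := hg
  have hunit : IsUnit (g - algebraMap K R c) := by
    have h1 : IsUnit (algebraMap K R (1 - c)) :=
      (IsUnit.mk0 (1 - c) (sub_ne_zero.2 hc.symm)).map _
    have h2 := IsNilpotent.isUnit_add_left_of_commute ⟨k, hk⟩ h1
      (Algebra.commutes (1 - c) (g - 1)).symm
    rwa [map_sub, map_one, add_comm, sub_add_sub_cancel] at h2
  have hsemi : SemiconjBy B (c • (g - 1)) (g - algebraMap K R c) := by
    rw [SemiconjBy, sub_mul, h, mul_smul_comm, mul_sub, smul_sub, mul_one, ← Algebra.smul_def]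
  have h2 := hsemi.pow_right k
  rw [SemiconjBy, smul_pow, hk, smul_zero, mul_zero] at h2
  exact ((hunit.pow k).mul_right_eq_zero).1 h2.symm

/-- If conjugation by `g` acts on the closure of `⟨h⟩` by raising to a `p`-adic power that is not
torsion, then `h` acts trivially in every unipotent continuous representation. -/
theorem map_eq_one_of_tendsto_pow {K R Γ : Type*} [Field K] [TopologicalSpace K]
    [IsTopologicalRing K] [Ring R] [TopologicalSpace R] [IsTopologicalRing R] [T2Space R]
    [Algebra K R] [ContinuousSMul K R] [Group Γ] [TopologicalSpace Γ] {A : Γ →* R}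
    (hA : Continuous A) (hnil : ∀ γ, IsNilpotent (A γ - 1)) {g h : Γ} {a : ℕ → ℕ} {c : K}
    (hconj : Tendsto (fun k ↦ h ^ a k) atTop (𝓝 (g * h * g⁻¹)))
    (ha : Tendsto (fun k ↦ (a k : K)) atTop (𝓝 c)) (hc : ∀ j ≠ 0, c ^ j ≠ 1) : A h = 1 := by
  by_contra hne
  set M := A h - 1 with hM
  have hM0 : M ≠ 0 := sub_ne_zero.2 hne
  have hAh : A h = 1 + M := by rw [hM, add_sub_cancel]
  obtain ⟨j, hj⟩ : ∃ j, nilpotencyClass M = j + 1 :=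
    Nat.exists_eq_succ_of_ne_zero fun h0 ↦ hM0 <| by
      have := pow_nilpotencyClass (hnil h)
      rw [← hM, h0, pow_zero] at this
      rw [← mul_one M, this, mul_zero]
  obtain ⟨h1, h2⟩ := (nilpotencyClass_eq_succ_iff (k := j)).1 hj
  have hj0 : j ≠ 0 := by
    rintro rfl
    rw [zero_add, pow_one] at h1
    exact hM0 h1
  have hinv : A g⁻¹ * A g = 1 := by rw [← map_mul, inv_mul_cancel, map_one]
  have hinv' : A g * A g⁻¹ = 1 := by rw [← map_mul, mul_inv_cancel, map_one]
  have lim1 : Tendsto (fun k ↦ (A (h ^ a k) - 1) ^ j) atTop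
      (𝓝 ((A (g * h * g⁻¹) - 1) ^ j)) :=
    (((hA.tendsto _).comp hconj).sub_const 1).pow j
  have lim2 : Tendsto (fun k ↦ ((a k : K) ^ j) • M ^ j) atTop (𝓝 (c ^ j • M ^ j)) :=
    (ha.pow j).smul_const _
  -- The identity is exact for the natural powers h^(a k); continuity carries it to the p-adic
  -- exponent c.
  have heq : (A (g * h * g⁻¹) - 1) ^ j = c ^ j • M ^ j := by
    refine tendsto_nhds_unique lim1 (lim2.congr fun k ↦ ?_)
    rw [map_pow, hAh, one_add_pow_sub_one_pow h1, Algebra.smul_def, map_pow, map_natCast]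
  have hpow : (A (g * h * g⁻¹) - 1) ^ j = A g * M ^ j * A g⁻¹ := by
    have h3 : A (g * h * g⁻¹) - 1 = A g * M * A g⁻¹ := by
      rw [map_mul, map_mul, hM, mul_sub, sub_mul, mul_one, hinv']
    have h4 (i : ℕ) : (A g * M * A g⁻¹) ^ i = A g * M ^ i * A g⁻¹ := by
      induction i with
      | zero => simp [hinv']
      | succ i ih =>
        rw [pow_succ, ih, pow_succ]
        simp only [mul_assoc]
        rw [← mul_assoc (A g⁻¹) (A g), hinv, one_mul]
    rw [h3, h4]
  refine h2 (eq_zero_of_mul_eq_smul_mul (hc j hj0) (hnil g) ?_)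
  rw [← smul_mul_assoc, ← heq, hpow, mul_assoc _ (A g⁻¹), hinv, mul_one]

end Unipotent

/-! ### Convergence in the Krull topology. -/

section Krull

/-- Convergence in the Krull topology can be tested on generators. -/
theorem tendsto_galois_adjoin {K E : Type*} [Field K] [Field E] [Algebra K E] {S : Set E}
    {ι : Type*} {l : Filter ι} {f : ι → Gal(IntermediateField.adjoin K S/K)}
    {σ : Gal(IntermediateField.adjoin K S/K)}
    (h : ∀ x (hx : x ∈ S), ∀ᶠ i in l,
      f i ⟨x, IntermediateField.subset_adjoin K S hx⟩ =
        σ ⟨x, IntermediateField.subset_adjoin K S hx⟩) :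
    Tendsto f l (𝓝 σ) := by
  have hall (x : IntermediateField.adjoin K S) : ∀ᶠ i in l, f i x = σ x := by
    obtain ⟨x, hx⟩ := x
    induction hx using IntermediateField.adjoin_induction with
    | mem x hx => exact h x hx
    | algebraMap x =>
      exact Eventually.of_forall fun i ↦ ((f i).commutes x).trans (σ.commutes x).symm
    | add x y hx hy ihx ihy =>
      filter_upwards [ihx, ihy] with i h1 h2
      exact ((map_add (f i) ⟨x, hx⟩ ⟨y, hy⟩).trans (congrArg₂ _ h1 h2)).trans
        (map_add σ ⟨x, hx⟩ ⟨y, hy⟩).symm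
    | inv x hx ih =>
      filter_upwards [ih] with i h1
      exact ((map_inv₀ (f i) ⟨x, hx⟩).trans (congrArg _ h1)).trans (map_inv₀ σ ⟨x, hx⟩).symm
    | mul x y hx hy ihx ihy =>
      filter_upwards [ihx, ihy] with i h1 h2
      exact ((map_mul (f i) ⟨x, hx⟩ ⟨y, hy⟩).trans (congrArg₂ _ h1 h2)).trans
        (map_mul σ ⟨x, hx⟩ ⟨y, hy⟩).symm
  have hone : Tendsto (fun i ↦ σ⁻¹ * f i) l (𝓝 1) := by
    intro s hs
    obtain ⟨F, hF, hFs⟩ := (krullTopology_mem_nhds_one_iff _ _ _).1 hs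
    -- A basic neighbourhood only sees a finite subextension, hence finitely many basis vectors.
    have hb : ∀ᶠ i in l, ∀ j, f i (Module.finBasis K F j) = σ (Module.finBasis K F j) :=
      eventually_all.2 fun j ↦ hall _
    refine mem_map.2 (hb.mono fun i hi ↦ hFs ?_)
    have hlin : (f i).toLinearMap ∘ₗ F.val.toLinearMap = σ.toLinearMap ∘ₗ F.val.toLinearMap :=
      (Module.finBasis K F).ext hi
    refine (IntermediateField.mem_fixingSubgroup_iff _ _).2 fun x hx ↦ ?_
    have hx' : f i x = σ x := LinearMap.congr_fun hlin ⟨x, hx⟩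
    rw [AlgEquiv.mul_apply, hx', ← AlgEquiv.mul_apply, inv_mul_cancel, AlgEquiv.one_apply]
  simpa using hone.const_mul σ

end Krull

/-! ### Galois theory of K_∞. -/

section KInfty

variable {p : ℕ} [Fact p.Prime] {K : Type*} {Kbar : Type*} [Field K] [CharZero K] [Field Kbar]
  [Algebra K Kbar] [IsAlgClosure K Kbar] {d : ℕ} {t : Fin d → K}

/-- The equations x^(p^n) = 1 and x^(p^n) = t_j have coefficients in K, so conjugation preserves the
generating set. -/
theorem isGalois_kInfty (p : ℕ) [Fact p.Prime] {K : Type*} (Kbar : Type*) [Field K] [CharZero K]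
    [Field Kbar] [Algebra K Kbar] [IsAlgClosure K Kbar] {d : ℕ} (t : Fin d → K) :
    IsGalois K (kInfty p Kbar t) := by
  have : Normal K Kbar := IsAlgClosure.normal K Kbar
  have : Algebra.IsAlgebraic K Kbar := IsAlgClosure.isAlgebraic
  have : Normal K (kInfty p Kbar t) := by
    rw [IntermediateField.normal_iff_forall_map_le']
    intro σ
    rw [kInfty, IntermediateField.adjoin_map, IntermediateField.adjoin_le_iff]
    rintro _ ⟨x, hx | ⟨j, n, hx⟩, rfl⟩
    · obtain ⟨n, hx⟩ := hx
      refine IntermediateField.subset_adjoin _ _ (Or.inl ⟨n, ?_⟩)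
      rw [← map_pow, hx, map_one]
    · refine IntermediateField.subset_adjoin _ _ (Or.inr ⟨j, n, ?_⟩)
      rw [← map_pow, hx]
      exact σ.commutes _
  exact ⟨⟩

theorem exists_isPrimitiveRoot_kInfty (p : ℕ) [Fact p.Prime] {K : Type*} (Kbar : Type*) [Field K]
    [CharZero K] [Field Kbar] [Algebra K Kbar] [IsAlgClosure K Kbar] {d : ℕ} (t : Fin d → K)
    (n : ℕ) : ∃ ζ : kInfty p Kbar t, IsPrimitiveRoot ζ (p ^ n) := by
  have : IsAlgClosed Kbar := IsAlgClosure.isAlgClosed K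
  have : CharZero Kbar := charZero_of_injective_algebraMap (algebraMap K Kbar).injective
  have hp : NeZero (p ^ n) := ⟨pow_ne_zero _ (Fact.out : p.Prime).ne_zero⟩
  have hp' : NeZero ((p ^ n : ℕ) : Kbar) := ⟨by exact_mod_cast hp.out⟩
  obtain ⟨z, hz⟩ := HasEnoughRootsOfUnity.exists_primitiveRoot Kbar (p ^ n)
  refine ⟨⟨z, IntermediateField.subset_adjoin _ _ (Or.inl ⟨n, hz.pow_eq_one⟩)⟩, ?_⟩
  exact IsPrimitiveRoot.of_map_of_injective (f := (kInfty p Kbar t).val) (by simpa using hz)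
    (kInfty p Kbar t).val.injective

theorem pow_zmod_val_natCast {M : Type*} [Monoid M] {N : ℕ} {ζ : M} (hζ : ζ ^ N = 1)
    (a : ℕ) : ζ ^ ((a : ZMod N)).val = ζ ^ a := by
  rw [ZMod.val_natCast]
  conv_rhs => rw [← Nat.mod_add_div a N, pow_add, pow_mul, hζ, one_pow, mul_one]

theorem toZModPow_eq_appr (z : ℤ_[p]) {m k : ℕ} (hmk : m ≤ k) :
    PadicInt.toZModPow m z = (z.appr k : ZMod (p ^ m)) := by
  rw [← sub_eq_zero, ← map_natCast (PadicInt.toZModPow m (p := p)), ← map_sub, ← RingHom.mem_ker,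
    PadicInt.ker_toZModPow]
  refine Ideal.span_singleton_le_span_singleton.2 (pow_dvd_pow _ hmk) (PadicInt.appr_spec k z)

theorem tendsto_padicInt_appr (z : ℤ_[p]) :
    Tendsto (fun k ↦ ((z.appr k : ℕ) : ℤ_[p])) atTop (𝓝 z) := by
  rw [tendsto_iff_norm_sub_tendsto_zero]
  refine squeeze_zero (fun _ ↦ norm_nonneg _) (fun k ↦ ?_)
    (tendsto_pow_atTop_nhds_zero_of_lt_one (norm_nonneg (p : ℤ_[p]))
      (PadicInt.norm_lt_one_iff_dvd _ |>.2 dvd_rfl))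
  rw [norm_sub_rev]
  obtain ⟨c, hc⟩ := Ideal.mem_span_singleton'.1 (PadicInt.appr_spec k z)
  rw [← hc, norm_mul, norm_pow]
  exact mul_le_of_le_one_left (by positivity) (PadicInt.norm_le_one c)

/-- `Γ` acts on `Gal(K_∞/K(μ_{p^∞}))` by conjugation through the cyclotomic character. -/
theorem tendsto_pow_appr_conj {g h : Gal(kInfty p Kbar t/K)}
    (hh : galCyclotomicCharacter p K (kInfty p Kbar t) h = 1) :
    Tendsto (fun k ↦ h ^ ((galCyclotomicCharacter p K (kInfty p Kbar t) g).val.appr k)) atTop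
      (𝓝 (g * h * g⁻¹)) := by
  set z := (galCyclotomicCharacter p K (kInfty p Kbar t) g).val with hz
  have hfix {ζ : kInfty p Kbar t} {n : ℕ} (hζ : ζ ^ p ^ n = 1) : h ζ = ζ := by
    rw [galCyclotomicCharacter_kInfty_spec p Kbar t h n ζ hζ, hh, Units.val_one, map_one,
      ← Nat.cast_one, pow_zmod_val_natCast hζ, pow_one]
  have hg {ζ : kInfty p Kbar t} {n k : ℕ} (hζ : ζ ^ p ^ n = 1) (hk : n ≤ k) : g ζ = ζ ^ z.appr k := by
    rw [galCyclotomicCharacter_kInfty_spec p Kbar t g n ζ hζ, ← hz, toZModPow_eq_appr z hk,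
      pow_zmod_val_natCast hζ]
  have hpow {x ζ : kInfty p Kbar t} {n : ℕ} (hζ : ζ ^ p ^ n = 1) (hx : h x = ζ * x) (k : ℕ) :
      (h ^ k) x = ζ ^ k * x := by
    induction k with
    | zero => simp
    | succ k ih => rw [pow_succ', AlgEquiv.mul_apply, ih, map_mul, map_pow, hfix hζ, hx]; ring
  refine tendsto_galois_adjoin fun x hx ↦ ?_
  set x' : kInfty p Kbar t := ⟨x, IntermediateField.subset_adjoin K _ hx⟩ with hx'
  change ∀ᶠ i in atTop, (h ^ z.appr i) x' = g (h (g⁻¹ x'))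
  have hgg : g (g⁻¹ x') = x' := by
    rw [← AlgEquiv.mul_apply, mul_inv_cancel, AlgEquiv.one_apply]
  rcases hx with ⟨n, hx⟩ | ⟨j, n, hx⟩
  · have h1 : x' ^ p ^ n = 1 := Subtype.ext hx
    have h2 : (g⁻¹ x') ^ p ^ n = 1 := by rw [← map_pow, h1, map_one]
    refine Eventually.of_forall fun k ↦ ?_
    rw [hfix h2, hgg, hpow (ζ := 1) (n := n) (one_pow _) (by rw [hfix h1, one_mul]), one_pow,
      one_mul]
  · have h1 : x' ^ p ^ n = algebraMap K (kInfty p Kbar t) (t j) := Subtype.ext hx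
    rcases eq_or_ne x' 0 with h0 | h0
    · rw [h0]; simp
    refine (eventually_ge_atTop n).mono fun k hk ↦ ?_
    have hroot (σ : Gal(kInfty p Kbar t/K)) : (σ x' / x') ^ p ^ n = 1 := by
      rw [div_pow, ← map_pow, h1, AlgEquiv.commutes, ← h1, div_self (pow_ne_zero _ h0)]
    -- Kummer cocycle: g⁻¹ x' is x' times a root of unity fixed by h, so h also multiplies it by ζ,
    -- and applying g turns ζ into ζ^χ(g).
    set ζ := h x' / x' with hζ
    have hζx : h x' = ζ * x' := by rw [hζ, div_mul_cancel₀ _ h0]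
    have hy : g⁻¹ x' = (g⁻¹ x' / x') * x' := by rw [div_mul_cancel₀ _ h0]
    have hhy : h (g⁻¹ x') = ζ * g⁻¹ x' := by
      rw [hy, map_mul, hfix (hroot g⁻¹), hζx]; ring
    rw [hhy, map_mul, hgg, hg (hroot h) hk, hpow (hroot h) hζx]

end KInfty

/-! ### Infinite ramification of the cyclotomic tower. -/

section Ramification

theorem norm_le_one_of_isIntegral_int {K : Type*} [NontriviallyNormedField K]
    [IsUltrametricDist K] {b : K} (hb : IsIntegral ℤ b) : ‖b‖ ≤ 1 :=
  Valued.integer.mem_iff.1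
    ((Valuation.integer.integers (NormedField.valuation (K := K))).mem_of_integral hb.tower_top)

/-- If a product of `m ≥ 1` elements `1 - η`, with `η` a primitive `p ^ (n + 1)`-th root of unity,
lies in a discretely valued field with uniformizer `ϖ`, then `|p| ^ m ≤ |ϖ| ^ n`. -/
theorem norm_prime_pow_card_le_of_prod_one_sub_mem {p : ℕ} [Fact p.Prime] {K : Type*}
    [NontriviallyNormedField K] [IsUltrametricDist K] [IsDiscreteValuationRing 𝒪[K]]
    [NormedAlgebra ℚ_[p] K] [CharZero K] {L : Type*} [Field L] [Algebra K L] {ι : Type*}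
    [Fintype ι] [Nonempty ι] {n : ℕ} {η : ι → L} (hη : ∀ s, IsPrimitiveRoot (η s) (p ^ (n + 1)))
    {y : K} (hy : algebraMap K L y = ∏ s, (1 - η s)) {ϖ : 𝒪[K]} (hϖ : Irreducible ϖ) :
    ‖(p : K)‖ ^ Fintype.card ι ≤ ‖ϖ‖ ^ n := by
  have hpp : p.Prime := Fact.out
  have hpnorm : ‖(p : K)‖ = ‖(p : ℚ_[p])‖ := by
    rw [← norm_algebraMap' K (p : ℚ_[p]), map_natCast]
  have hp0 : (p : K) ≠ 0 := by exact_mod_cast hpp.ne_zero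
  have hinj := (algebraMap K L).injective
  have : CharZero L := charZero_of_injective_algebraMap hinj
  choose c hc hc' using fun s ↦ (hη s).exists_isIntegral_prime_eq
  choose c₁ hc₁ hc₁' using fun s ↦ exists_isIntegral_one_sub_pow_eq (hη s).pow_eq_one
  have hy0 : y ≠ 0 := by
    rintro rfl
    rw [map_zero, eq_comm, Finset.prod_eq_zero_iff] at hy
    obtain ⟨s, -, hs⟩ := hy
    have h := hc' s
    rw [hs, zero_pow (Nat.totient_pos.2 (pow_pos hpp.pos _)).ne', zero_mul] at h
    exact hpp.ne_zero (by exact_mod_cast h)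
  -- The quotient p^m / y^φ is a product of algebraic integers and lies in K, so its norm is at most
  -- 1.
  have hnorm1 : ‖(p : K)‖ ^ Fintype.card ι ≤ ‖y‖ ^ (p ^ (n + 1)).totient := by
    have h1 : algebraMap K L
        ((p : K) ^ Fintype.card ι / y ^ (p ^ (n + 1)).totient) = ∏ s, c s := by
      have hy0' : algebraMap K L y ≠ 0 := by simpa using hy0
      rw [map_div₀, map_pow, map_pow, map_natCast, div_eq_iff (pow_ne_zero _ hy0'), hy,
        ← Finset.prod_pow, ← Finset.prod_mul_distrib]
      simp_rw [mul_comm (c _), ← hc']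
      simp
    have h2 : IsIntegral ℤ ((p : K) ^ Fintype.card ι / y ^ (p ^ (n + 1)).totient) := by
      rw [← isIntegral_algebraMap_iff hinj, h1]
      exact IsIntegral.prod _ fun s _ ↦ hc s
    have h3 := norm_le_one_of_isIntegral_int h2
    rwa [norm_div, norm_pow, norm_pow,
      div_le_one₀ (pow_pos (norm_pos_iff.2 hy0) _)] at h3
  have hnorm2 : ‖y‖ < 1 := by
    have h1 : algebraMap K L
        (y ^ p ^ (n + 1) / (p : K) ^ Fintype.card ι) = ∏ s, c₁ s := by
      have hp0' : (p : L) ≠ 0 := by exact_mod_cast hpp.ne_zero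
      rw [map_div₀, map_pow, map_pow, map_natCast, div_eq_iff (pow_ne_zero _ hp0'), hy,
        ← Finset.prod_pow]
      simp_rw [hc₁']
      rw [Finset.prod_mul_distrib, mul_comm]
      simp
    have h2 : IsIntegral ℤ (y ^ p ^ (n + 1) / (p : K) ^ Fintype.card ι) := by
      rw [← isIntegral_algebraMap_iff hinj, h1]
      exact IsIntegral.prod _ fun s _ ↦ hc₁ s
    have h3 := norm_le_one_of_isIntegral_int h2
    rw [norm_div, norm_pow, norm_pow, div_le_one₀ (pow_pos (norm_pos_iff.2 hp0) _)] at h3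
    have h4 : ‖(p : K)‖ ^ Fintype.card ι < 1 :=
      pow_lt_one₀ (norm_nonneg _) (by rw [hpnorm]; exact Padic.norm_p_lt_one) Fintype.card_ne_zero
    exact (pow_lt_one_iff_of_nonneg (norm_nonneg _) (pow_pos hpp.pos _).ne').1 (h3.trans_lt h4)
  -- Discreteness enters here: no norm lies strictly between |ϖ| and 1.
  have hnorm3 : ‖y‖ ≤ ‖ϖ‖ := by
    have hmem : (⟨y, Valued.integer.mem_iff.2 hnorm2.le⟩ : 𝒪[K]) ∈ (𝓂[K] : Set 𝒪[K]) := by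
      refine (IsLocalRing.mem_maximalIdeal _).2 fun hu ↦ ?_
      exact hnorm2.ne (Valued.integer.isUnit_iff_norm_eq_one.1 hu)
    rw [hϖ.maximalIdeal_eq_closedBall, mem_closedBall_zero_iff] at hmem
    exact hmem
  have hnφ : n ≤ (p ^ (n + 1)).totient := by
    rw [Nat.totient_prime_pow_succ hpp]
    exact (Nat.lt_pow_self hpp.one_lt).le.trans
      (Nat.le_mul_of_pos_right _ (Nat.sub_pos_of_lt hpp.one_lt))
  refine hnorm1.trans ?_
  calc ‖y‖ ^ (p ^ (n + 1)).totient ≤ ‖ϖ‖ ^ (p ^ (n + 1)).totient := by gcongr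
    _ ≤ ‖ϖ‖ ^ n := pow_le_pow_of_le_one (norm_nonneg _)
      (Valued.integer.norm_irreducible_lt_one hϖ).le hnφ

/-- In a discretely valued field of mixed characteristic, the logarithm of the cyclotomic character
of `K_∞` is not identically zero. -/
theorem exists_padicUnitLog_galCyclotomicCharacter_ne_zero (p : ℕ) [Fact p.Prime] {K : Type*}
    [NontriviallyNormedField K] [IsUltrametricDist K] [IsDiscreteValuationRing 𝒪[K]]
    [NormedAlgebra ℚ_[p] K] [CharZero K] (Kbar : Type*) [Field Kbar] [Algebra K Kbar]
    [IsAlgClosure K Kbar] {d : ℕ} (t : Fin d → K) :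
    ∃ γ : Gal(kInfty p Kbar t/K),
      padicUnitLog p (galCyclotomicCharacter p K (kInfty p Kbar t) γ) ≠ 0 := by
  by_contra! hall
  have hpp : p.Prime := Fact.out
  have : IsGalois K (kInfty p Kbar t) := isGalois_kInfty p Kbar t
  have hm0 : NeZero ((p - 1) * p) :=
    ⟨mul_ne_zero (Nat.sub_pos_of_lt hpp.one_lt).ne' hpp.ne_zero⟩
  set H : Subgroup ℤ_[p]ˣ := rootsOfUnity ((p - 1) * p) ℤ_[p] with hH
  have : Fintype H := Fintype.ofFinite H
  have hχ (γ : Gal(kInfty p Kbar t/K)) :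
      galCyclotomicCharacter p K (kInfty p Kbar t) γ ∈ H :=
    (mem_rootsOfUnity _ _).2 (pow_eq_one_of_padicUnitLog_eq_zero (hall γ))
  obtain ⟨ϖ, hϖ⟩ := IsDiscreteValuationRing.exists_irreducible 𝒪[K]
  have hp0 : (p : K) ≠ 0 := by exact_mod_cast hpp.ne_zero
  -- This n violates the bound |p|^|H| ≤ |ϖ|^n proved for norm products indexed by H.
  obtain ⟨n, hn⟩ := exists_pow_lt_of_lt_one
    (pow_pos (norm_pos_iff.2 hp0) (Fintype.card H)) (Valued.integer.norm_irreducible_lt_one hϖ)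
  obtain ⟨ζ, hζ⟩ := exists_isPrimitiveRoot_kInfty p Kbar t (n + 1)
  obtain ⟨η, hη, hγη⟩ : ∃ η : ℤ_[p]ˣ → kInfty p Kbar t,
      (∀ s, IsPrimitiveRoot (η s) (p ^ (n + 1))) ∧
      ∀ γ s, γ (η s) = η (galCyclotomicCharacter p K (kInfty p Kbar t) γ * s) := by
    refine ⟨fun s ↦ ζ ^ (PadicInt.toZModPow (n + 1) s.val).val, fun s ↦
      hζ.pow_of_coprime _ (ZMod.val_coe_unit_coprime
        (Units.map (PadicInt.toZModPow (p := p) (n + 1)).toMonoidHom s)), fun γ s ↦ ?_⟩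
    beta_reduce
    rw [map_pow, galCyclotomicCharacter_kInfty_spec p Kbar t γ (n + 1) ζ hζ.pow_eq_one, ← pow_mul,
      Units.val_mul, map_mul, ← pow_zmod_val_natCast hζ.pow_eq_one, Nat.cast_mul]
    simp
  -- With η s = ζ^s, an element γ translates the index by χ(γ) ∈ H, so the product over H is
  -- Γ-invariant.
  obtain ⟨y, hy⟩ : ∃ y : K, algebraMap K (kInfty p Kbar t) y = ∏ s : H, (1 - η s) := by
    refine (InfiniteGalois.mem_range_algebraMap_iff_fixed _).2 fun γ ↦ ?_
    rw [map_prod]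
    simp_rw [map_sub, map_one, hγη]
    exact Fintype.prod_equiv (Equiv.mulLeft (⟨_, hχ γ⟩ : H)) _ (fun s : H ↦ 1 - η s) fun s ↦ by
      rw [Equiv.coe_mulLeft, Subgroup.coe_mul]
  exact hn.not_ge (norm_prime_pow_card_le_of_prod_one_sub_mem (fun s : H ↦ hη s) hy hϖ)

end Ramification

/-! ### From unipotent representations to one nilpotent operator. -/

section Structure

/-- Unipotent continuous representations of a compact group which are trivial on the kernel of a
continuous `p`-adic character `ℓ` are of the form `γ ↦ exp (ℓ γ • N)`. -/
theorem exists_eq_sum_smul_pow_of_unipotent {p : ℕ} [Fact p.Prime] {K R Γ : Type*}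
    [NormedField K] [NormedAlgebra ℚ_[p] K] [CharZero K] [Ring R] [TopologicalSpace R]
    [IsTopologicalRing R] [T2Space R] [Algebra K R] [ContinuousSMul K R] [Group Γ]
    [TopologicalSpace Γ] [CompactSpace Γ] {A : Γ →* R} (hA : Continuous A)
    (hnil : ∀ γ, IsNilpotent (A γ - 1)) {ℓ : Γ → ℚ_[p]} (hℓ : Continuous ℓ)
    (hmul : ∀ γ γ', ℓ (γ * γ') = ℓ γ + ℓ γ') (hker : ∀ γ, ℓ γ = 0 → A γ = 1)
    (hne : ∃ γ, ℓ γ ≠ 0) :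
    ∃ (N : R) (m : ℕ), N ^ m = 0 ∧ ∀ γ, A γ = ∑ i ∈ Finset.range m,
      ((i.factorial : K)⁻¹ * algebraMap ℚ_[p] K (ℓ γ) ^ i) • N ^ i := by
  let _ : Algebra ℚ R := Algebra.compHom R (algebraMap ℚ K)
  have : IsScalarTower ℚ K R := IsScalarTower.of_algebraMap_eq fun _ ↦ rfl
  have hone : ℓ 1 = 0 := by simpa using hmul 1 1
  have hinv (γ) : ℓ γ⁻¹ = -ℓ γ := by
    have h := hmul γ γ⁻¹
    rw [mul_inv_cancel, hone] at h
    exact (neg_eq_of_add_eq_zero_right h.symm).symm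
  have hpow (γ) (k : ℕ) : ℓ (γ ^ k) = k * ℓ γ := by
    induction k with
    | zero => simp [hone]
    | succ k ih => rw [pow_succ, hmul, ih]; push_cast; ring
  -- Maximality of |ℓ γ₀| makes every ratio ℓ γ / ℓ γ₀ a p-adic integer z, so γ can be compared with
  -- the powers of γ₀ approximating γ₀^z.
  obtain ⟨γ₀, -, hmax⟩ := isCompact_univ.exists_isMaxOn ⟨(1 : Γ), trivial⟩ hℓ.norm.continuousOn
  have h0 : ℓ γ₀ ≠ 0 := by
    obtain ⟨γ, hγ⟩ := hne
    exact norm_pos_iff.1 ((norm_pos_iff.2 hγ).trans_le (hmax (Set.mem_univ γ)))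
  obtain ⟨N₀, ⟨m, hm⟩, hN₀⟩ := (hnil γ₀).exists_exp_eq_one_add
  rw [add_sub_cancel] at hN₀
  have hexp (k : ℕ) : A (γ₀ ^ k) =
      ∑ i ∈ Finset.range m, ((i.factorial : K)⁻¹ * (k : K) ^ i) • N₀ ^ i := by
    rw [map_pow, ← hN₀, ← IsNilpotent.exp_nsmul ⟨m, hm⟩,
      IsNilpotent.exp_eq_sum (k := m) (by rw [smul_pow, hm, smul_zero])]
    refine Finset.sum_congr rfl fun i _ ↦ ?_
    rw [smul_pow, mul_smul, ← Nat.cast_pow, Nat.cast_smul_eq_nsmul K,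
      ← algebraMap_smul K ((i.factorial : ℚ)⁻¹), map_inv₀, map_natCast]
  have halg : Continuous (algebraMap ℚ_[p] K) := algebraMapCLM ℚ_[p] K |>.continuous
  refine ⟨(algebraMap ℚ_[p] K (ℓ γ₀))⁻¹ • N₀, m, by rw [smul_pow, hm, smul_zero], fun γ ↦ ?_⟩
  let z : ℤ_[p] := ⟨ℓ γ / ℓ γ₀, by
    rw [norm_div]
    exact div_le_one_of_le₀ (hmax (Set.mem_univ γ)) (norm_nonneg _)⟩
  have hz : Tendsto (fun k ↦ ((z.appr k : ℕ) : ℚ_[p])) atTop (𝓝 (ℓ γ / ℓ γ₀)) := by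
    have h := ((continuous_subtype_val (p := fun x : ℚ_[p] ↦ ‖x‖ ≤ 1)).tendsto z).comp
      (tendsto_padicInt_appr z)
    refine h.congr fun k ↦ ?_
    exact PadicInt.coe_natCast _
  -- These powers need not converge in Γ; compactness supplies an ultrafilter limit. It agrees with
  -- γ modulo ker ℓ, on which A is trivial.
  let U : Ultrafilter Γ := (hyperfilter ℕ).map fun k ↦ γ₀ ^ z.appr k
  have hU : Tendsto (fun k ↦ γ₀ ^ z.appr k) (hyperfilter ℕ) (𝓝 U.lim) := U.le_nhds_lim
  have hzU := hz.mono_left Nat.hyperfilter_le_atTop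
  have hℓlim : ℓ U.lim = ℓ γ := by
    refine tendsto_nhds_unique ((hℓ.tendsto _).comp hU) ?_
    have h := hzU.mul_const (ℓ γ₀)
    rw [div_mul_cancel₀ _ h0] at h
    exact h.congr fun k ↦ (hpow _ _).symm
  have hAlim : A U.lim = A γ := by
    have h := hker (U.lim * γ⁻¹) (by rw [hmul, hinv, hℓlim, add_neg_cancel])
    rw [← inv_mul_cancel_right U.lim γ, mul_assoc, ← mul_assoc U.lim, map_mul]
    simp [h]
  rw [← hAlim]
  refine tendsto_nhds_unique ((hA.tendsto _).comp hU) ?_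
  have hlim : Tendsto (fun k ↦ ∑ i ∈ Finset.range m,
      ((i.factorial : K)⁻¹ * algebraMap ℚ_[p] K (z.appr k : ℕ) ^ i) • N₀ ^ i) (hyperfilter ℕ)
      (𝓝 (∑ i ∈ Finset.range m,
        ((i.factorial : K)⁻¹ * algebraMap ℚ_[p] K (ℓ γ / ℓ γ₀) ^ i) • N₀ ^ i)) :=
    tendsto_finsetSum _ fun i _ ↦
      ((((halg.tendsto _).comp hzU).pow i).const_mul _).smul_const _
  have hrw : ∑ i ∈ Finset.range m, ((i.factorial : K)⁻¹ * algebraMap ℚ_[p] K (ℓ γ) ^ i) •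
      ((algebraMap ℚ_[p] K (ℓ γ₀))⁻¹ • N₀) ^ i = ∑ i ∈ Finset.range m,
        ((i.factorial : K)⁻¹ * algebraMap ℚ_[p] K (ℓ γ / ℓ γ₀) ^ i) • N₀ ^ i := by
    refine Finset.sum_congr rfl fun i _ ↦ ?_
    rw [smul_pow, smul_smul, map_div₀, div_pow, inv_pow, div_eq_mul_inv, mul_assoc]
  rw [hrw]
  refine hlim.congr fun k ↦ ?_
  rw [Function.comp_apply, hexp, map_natCast]

/-- Since g acts trivially on each successive quotient, g - 1 moves every step of the series into
the previous one. -/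
theorem AllJordanHolderFactorsTrivial.isNilpotent_sub_one {K G V : Type*} [Field K]
    [Group G] [AddCommGroup V] [Module K V] {ρ : Representation K G V}
    (h : AllJordanHolderFactorsTrivial ρ) (g : G) : IsNilpotent (ρ g - 1) := by
  obtain ⟨s, hbot, htop, hs⟩ := h
  have hstep (i : Fin s.length) (v : ρ.asModule) (hv : v ∈ s i.succ) :
      MonoidAlgebra.of K G g • v - v ∈ s i.castSucc := by
    obtain ⟨e⟩ := hs i
    have htriv (w : (Representation.trivial K G K).asModule) :
        MonoidAlgebra.of K G g • w = w := by
      rw [MonoidAlgebra.of_apply, Representation.single_smul, one_smul]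
      rfl
    set v' : s i.succ := ⟨v, hv⟩
    have h1 : MonoidAlgebra.of K G g • (Submodule.Quotient.mk v' :
        s i.succ ⧸ (s i.castSucc).submoduleOf (s i.succ)) = Submodule.Quotient.mk v' :=
      e.injective (by rw [map_smul, htriv])
    rw [← Submodule.Quotient.mk_smul, Submodule.Quotient.eq] at h1
    exact h1
  have hpow (i : ℕ) (hi : i < s.length + 1) (v : ρ.asModule) (hv : v ∈ s ⟨i, hi⟩) :
      ((ρ g - 1) ^ i) (ρ.asModuleEquiv v) = 0 := by
    induction i generalizing v with
    | zero =>
      have hv' : v ∈ s.head := hv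
      rw [hbot, Submodule.mem_bot] at hv'
      rw [hv', map_zero, map_zero]
    | succ i ih =>
      have h1 := ih (by omega) _ (hstep ⟨i, by omega⟩ v hv)
      rw [pow_succ, Module.End.mul_apply]
      rw [map_sub, Representation.asModuleEquiv_map_smul, MonoidAlgebra.of_apply,
        Representation.asAlgebraHom_single_one] at h1
      exact h1
  refine ⟨s.length, LinearMap.ext fun v ↦ ?_⟩
  have hlast : ρ.asModuleEquiv.symm v ∈ s (Fin.last _) := by
    change _ ∈ s.last
    rw [htop]
    trivial
  simpa using hpow s.length (by omega) _ hlast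

/-- A representation of the form `γ ↦ exp (log χ(γ) • N)` with `N` nilpotent is a direct sum of
representations `K[log t]^{<r}`. -/
theorem exists_equiv_directSum_logTRep {p : ℕ} [Fact p.Prime] {K L : Type*} [Field K] [CharZero K]
    [Field L] [Algebra K L] [Algebra ℚ_[p] K] {V : Type*} [AddCommGroup V] [Module K V]
    [FiniteDimensional K V] {ρ : Representation K Gal(L/K) V} {N : Module.End K V} {m : ℕ}
    (hN : N ^ m = 0) (hρ : ∀ γ, ρ γ = ∑ i ∈ Finset.range m,
      ((i.factorial : K)⁻¹ * logChi p K L γ ^ i) • N ^ i) :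
    ∃ (k : ℕ) (r : Fin k → ℕ), (∀ i, 0 < r i) ∧
      Nonempty (ρ.Equiv (Representation.directSum fun i ↦ logTRep p K L (r i))) := by
  obtain ⟨k, r, hr, e, he⟩ := exists_linearEquiv_directSum_degreeLT N ⟨m, hN⟩
  refine ⟨k, r, hr, ⟨Representation.Equiv.mk e fun γ ↦ LinearMap.ext fun v ↦ ?_⟩⟩
  refine DFinsupp.ext fun j ↦ Subtype.ext ?_
  change (e (ρ γ v) j : K[X]) = Polynomial.taylor (logChi p K L γ) (e v j : K[X])
  have hiter (i : ℕ) : (e ((N ^ i) v) j : K[X]) = Polynomial.derivative^[i] (e v j : K[X]) := by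
    induction i with
    | zero => rfl
    | succ i ih => rw [pow_succ', Module.End.mul_apply, he, ih, Function.iterate_succ_apply']
  -- The bound m + r j is large enough for both truncated exponentials, that of N and that of d/dX.
  have hdeg : (e v j : K[X]).natDegree < m + r j := by
    have h1 := Polynomial.mem_degreeLT.1 (e v j).2
    rcases eq_or_ne (e v j : K[X]) 0 with h0 | h0
    · rw [h0, Polynomial.natDegree_zero]
      have := hr j
      omega
    · have := (Polynomial.natDegree_lt_iff_degree_lt h0).2 h1
      omega
  have hρ' : ρ γ = ∑ i ∈ Finset.range (m + r j),
      ((i.factorial : K)⁻¹ * logChi p K L γ ^ i) • N ^ i := by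
    rw [hρ, Finset.sum_subset (Finset.range_mono (Nat.le_add_right m (r j)))]
    intro i _ hi
    rw [pow_eq_zero_of_le (by simpa using hi) hN, smul_zero]
  rw [Polynomial.taylor_eq_sum_smul_iterate_derivative _ hdeg, hρ', LinearMap.sum_apply, map_sum,
    DFinsupp.finsetSum_apply, AddSubmonoidClass.coe_finsetSum]
  refine Finset.sum_congr rfl fun i _ ↦ ?_
  rw [LinearMap.smul_apply, map_smul, ← hiter]
  rfl

end Structure

/-! ### Factorisation through log χ and conclusion. -/

section Main

theorem continuous_toMatrixAlgEquiv_comp {K Γ V ι : Type*} [NontriviallyNormedField K]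
    [CompleteSpace K] [TopologicalSpace Γ] [AddCommGroup V] [Module K V]
    [FiniteDimensional K V] [TopologicalSpace V] [IsTopologicalAddGroup V] [ContinuousSMul K V]
    [T2Space V] [Fintype ι] [DecidableEq ι] (b : Module.Basis ι K V) {f : Γ → V →ₗ[K] V}
    (hf : Continuous fun x : Γ × V ↦ f x.1 x.2) :
    Continuous fun γ ↦ LinearMap.toMatrixAlgEquiv b (f γ) := by
  refine continuous_matrix fun i j ↦ ?_
  simp_rw [LinearMap.toMatrixAlgEquiv_apply]
  exact (LinearMap.continuous_of_finiteDimensional (b.coord i)).comp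
    (hf.comp (Continuous.prodMk_left (b j)))

/-- A continuous unipotent representation of `Gal(K_∞/K)` is trivial on the kernel of the logarithm
of the cyclotomic character. -/
theorem map_eq_one_of_padicUnitLog_galCyclotomicCharacter_eq_zero {p : ℕ} [Fact p.Prime]
    {K : Type*} [NontriviallyNormedField K] [IsUltrametricDist K] [IsDiscreteValuationRing 𝒪[K]]
    [NormedAlgebra ℚ_[p] K] [CharZero K] {Kbar : Type*} [Field Kbar] [Algebra K Kbar]
    [IsAlgClosure K Kbar] {d : ℕ} {t : Fin d → K} {R : Type*} [Ring R] [TopologicalSpace R]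
    [IsTopologicalRing R] [T2Space R] [Algebra K R] [ContinuousSMul K R]
    {A : Gal(kInfty p Kbar t/K) →* R} (hA : Continuous A) (hnil : ∀ γ, IsNilpotent (A γ - 1))
    {γ : Gal(kInfty p Kbar t/K)}
    (hγ : padicUnitLog p (galCyclotomicCharacter p K (kInfty p Kbar t) γ) = 0) : A γ = 1 := by
  let _ : Algebra ℚ R := Algebra.compHom R (algebraMap ℚ K)
  have hpp : p.Prime := Fact.out
  obtain ⟨g, hg⟩ := exists_padicUnitLog_galCyclotomicCharacter_ne_zero p (K := K) Kbar t
  set u := galCyclotomicCharacter p K (kInfty p Kbar t) g with hu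
  -- The exponent (p-1)p kills the kernel of log on ℤ_pˣ, so it moves γ into ker χ.
  refine eq_one_of_isNilpotent_sub_one_of_pow_eq_one (hnil γ)
    (mul_ne_zero (Nat.sub_pos_of_lt hpp.one_lt).ne' hpp.ne_zero) ?_
  rw [← map_pow]
  refine map_eq_one_of_tendsto_pow (K := K) (c := algebraMap ℚ_[p] K u.val) hA hnil
    (tendsto_pow_appr_conj (g := g) (by rw [map_pow, pow_eq_one_of_padicUnitLog_eq_zero hγ]))
    ?_ fun j hj hj1 ↦ ?_
  · have h := ((algebraMapCLM ℚ_[p] K).continuous.comp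
      (continuous_subtype_val (p := fun x : ℚ_[p] ↦ ‖x‖ ≤ 1))).tendsto u.val
    refine (h.comp (tendsto_padicInt_appr u.val)).congr fun k ↦ ?_
    exact (congrArg (algebraMap ℚ_[p] K) (PadicInt.coe_natCast _)).trans (map_natCast _ _)
  · rw [← map_pow, map_eq_one_iff _ (algebraMap ℚ_[p] K).injective] at hj1
    have h1 : u ^ j = 1 := Units.ext (PadicInt.ext (by push_cast; exact hj1))
    have h2 := padicUnitLog_pow u j
    rw [h1, padicUnitLog_one, eq_comm, mul_eq_zero] at h2
    exact h2.elim (by exact_mod_cast hj) hg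

end Main

theorem mainTheorem8 (p : ℕ) [Fact p.Prime]
    -- `K` is a complete discretely valued field of mixed characteristic `(0, p)`, with its absolute
    -- value normalised by `|p| = 1/p`, that is, extending the one of `ℚ_p`
    {K : Type*} [NontriviallyNormedField K] [IsUltrametricDist K] [CompleteSpace K]
    [IsDiscreteValuationRing 𝒪[K]] [CharP 𝓀[K] p] [NormedAlgebra ℚ_[p] K]
    {Kbar : Type*} [Field Kbar] [Algebra K Kbar] [IsAlgClosure K Kbar]
    -- `t₁, …, t_d` lift a `p`-basis of the residue field, so `[k_K : k_K^p] = p^d < ∞`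
    {d : ℕ} (t : Fin d → 𝒪[K]) (ht : IsPBasis p fun j ↦ IsLocalRing.residue 𝒪[K] (t j))
    -- `V` is a finite dimensional `K`-vector space with its canonical topology
    {V : Type*} [AddCommGroup V] [Module K V] [FiniteDimensional K V] [TopologicalSpace V]
    [IsTopologicalAddGroup V] [ContinuousSMul K V] [T2Space V]
    -- a continuous `K`-linear action of `Γ = Gal(K_∞/K)` on `V`
    (ρ : Representation K Gal(kInfty p Kbar (fun j ↦ (t j : K))/K) V)
    (hcont : Continuous fun x : Gal(kInfty p Kbar (fun j ↦ (t j : K))/K) × V ↦ ρ x.1 x.2)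
    (hJH : AllJordanHolderFactorsTrivial ρ) :
    ∃ (k : ℕ) (r : Fin k → ℕ), (∀ i, 0 < r i) ∧
      Nonempty (ρ.Equiv (Representation.directSum fun i ↦
        logTRep p K (kInfty p Kbar (fun j ↦ (t j : K))) (r i))) := by
  have : CharZero K := charZero_of_injective_algebraMap (algebraMap ℚ_[p] K).injective
  have := isGalois_kInfty p Kbar (fun j ↦ (t j : K))
  let b := Module.finBasis K V
  let A := (LinearMap.toMatrixAlgEquiv b).toMulEquiv.toMonoidHom.comp ρ
  have hA : Continuous A := continuous_toMatrixAlgEquiv_comp b hcont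
  have hnil (γ) : IsNilpotent (A γ - 1) := by
    have h := (hJH.isNilpotent_sub_one γ).map (LinearMap.toMatrixAlgEquiv b)
    rwa [map_sub, map_one] at h
  obtain ⟨N, m, hN, hρ⟩ := exists_eq_sum_smul_pow_of_unipotent (K := K) hA hnil
    (continuous_padicUnitLog.comp (cyclotomicCharacter.continuous p K
      (kInfty p Kbar (fun j ↦ (t j : K)))))
    (fun γ γ' ↦ (congrArg (padicUnitLog p) (map_mul
      (galCyclotomicCharacter p K (kInfty p Kbar (fun j ↦ (t j : K)))) γ γ')).trans
      (padicUnitLog_mul _ _))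
    (fun γ hγ ↦ map_eq_one_of_padicUnitLog_galCyclotomicCharacter_eq_zero hA hnil hγ)
    (exists_padicUnitLog_galCyclotomicCharacter_ne_zero p Kbar _)
  refine exists_equiv_directSum_logTRep (N := (LinearMap.toMatrixAlgEquiv b).symm N) (m := m)
    (by rw [← map_pow, hN, map_zero]) fun γ ↦ (LinearMap.toMatrixAlgEquiv b).injective ?_
  rw [map_sum]
  simp_rw [map_smul, map_pow, AlgEquiv.apply_symm_apply]
  exact hρ γ
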